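/- Let $0<p<1$ and let series-parallel networks grow randomly as follows (Bernoulli model). The network of size $1$ is a single edge, labelled $1$, from the source to the sink. The network of size $n\ge 2$ arises from the network of size $n-1$ by choosing one of its $n-1$ directed edges $(x,y)$ uniformly at random and then, independently, with probability $p$ inserting an additional parallel edge $(x,y)$ labelled $n$, and with probability $1-p$ replacing the chosen edge by the two edges $(x,z)$, which keeps the label, and $(z,y)$, labelled $n$, with $z$ a new node. Let $P_n$ be the number of different directed paths from the source to the sink in the network of size $n$, where paths using different parallel edges are different. Then, for all $n\ge 1$, $$\mathbb{E}(P_n)=\sum_{j=0}^{n-1}(-1)^{n+j-1}\binom{(2p-1)j-1}{n-1}\sum_{k=0}^{n-1}\binom{k}{j}\Big(\frac{p}{2p-1}\Big)^{k}\qquad\text{if } p\ne\tfrac12,$$ $$\mathbb{E}(P_n)=\sum_{k=0}^{n-1}\frac{(-1)^k}{2^k}\,B_k\big(-H_{n-1}^{(1)},-H_{n-1}^{(2)},-2H_{n-1}^{(3)},\ldots,-(k-1)!\,H_{n-1}^{(k)}\big)\qquad\text{if } p=\tfrac12,$$ where $B_k$ is the $k$-th complete Bell polynomial, i.e. $\sum_{k\ge0}B_k(x_1,\ldots,x_k)\frac{t^k}{k!}=\exp\big(\sum_{i\ge1}x_i\frac{t^i}{i!}\big)$,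 and $H_n^{(m)}=\sum_{j=1}^n j^{-m}$. Moreover, $$\mathbb{E}(P_n)=\frac{1}{1-p}\,\alpha_p^{\,n}+R_p(n),$$ where $$\alpha_p=\frac{1}{1-\big(\frac{p}{1-p}\big)^{\frac{1}{1-2p}}}\ \text{ for } p\ne\tfrac12,\qquad \alpha_{1/2}=\frac{1}{1-e^{-2}}=\lim_{p\to\frac12}\frac{1}{1-\big(\frac{p}{1-p}\big)^{\frac{1}{1-2p}}},$$ and, for fixed $p$ and $n\to\infty$, $$R_p(n)=-\frac{1-2p}{p\,\Gamma(2p)}\,n^{2p-1}+\mathcal{O}\big(n^{2(2p-1)}\big)\quad\text{for } 0<p<\tfrac12,$$ $$R_p(n)=-\frac{2}{\log n}+\mathcal{O}\Big(\frac{1}{\log^2 n}\Big)\quad\text{for } p=\tfrac12,$$ $$R_p(n)=-\frac{2p-1}{1-p}+\mathcal{O}\big(n^{1-2p}\big)\quad\text{for } \tfrac12<p<1.$$ -/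

import Mathlib

open Filter Topology Asymptotics MeasureTheory

/-- A network with `n` labelled directed edges (parallel edges allowed): the edge `j : Fin n`
carries the label `j + 1` and leads from the node `tail j` to the node `head j`.
Nodes are named by natural numbers, the source being `0` and the sink being `1`. -/
structure Network (n : ℕ) where
  tail : Fin n → ℕ
  head : Fin n → ℕ

namespace Network

/-- All sets of networks are measurable. -/
instance instMeasurableSpace (n : ℕ) : MeasurableSpace (Network n) := ⊤

/-- The network without edges (a convention for size `0`). -/
def empty : Network 0 where
  tail := Fin.elim0
  head := Fin.elim0

/-- The network consisting of a single edge from the source to the sink. -/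
def single : Network 1 where
  tail := fun _ => 0
  head := fun _ => 1

variable {n : ℕ}

/-- Parallel doubling of the edge `j = (x, y)`: an additional edge `(x, y)` with the next label
is inserted. -/
def parallel (G : Network n) (j : Fin n) : Network (n + 1) where
  tail := Fin.snoc (α := fun _ => ℕ) G.tail (G.tail j)
  head := Fin.snoc (α := fun _ => ℕ) G.head (G.head j)

/-- Serial doubling of the edge `j = (x, y)`: it is replaced by `(x, z)`, which keeps its label,
and `(z, y)`, which gets the next label. The node `z = n + 1` is new, since the nodes of a network
of size `n ≥ 1` grown from `single` are among `0, …, n`. -/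
def serial (G : Network n) (j : Fin n) : Network (n + 1) where
  tail := Fin.snoc (α := fun _ => ℕ) G.tail (n + 1)
  head := Fin.snoc (α := fun _ => ℕ) (Function.update G.head j (n + 1)) (G.head j)

/-- `G.IsWalk u l v`: the edges in the list `l`, traversed one after the other in their direction,
lead from the node `u` to the node `v`. -/
def IsWalk (G : Network n) : ℕ → List (Fin n) → ℕ → Prop
  | u, [], v => u = v
  | u, e :: l, v => G.tail e = u ∧ G.IsWalk (G.head e) l v

/-- `l` is (the list of edges of) a directed path from the source to the sink, that is, a walk
that visits no node twice. -/
def IsSourceSinkPath (G : Network n) (l : List (Fin n)) : Prop :=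
  G.IsWalk 0 l 1 ∧ (0 :: l.map G.head).Nodup

/-- The number of different source-to-sink paths (paths that use different ones of two parallel
edges are different). -/
noncomputable def numPaths (G : Network n) : ℕ :=
  Set.ncard {l : List (Fin n) | G.IsSourceSinkPath l}

end Network

/-- A biased coin, showing `true` with probability `p` and `false` with probability `1 - p`. -/
noncomputable def biasedCoin (p : ℝ) (hp : p ∈ Set.Ioo (0 : ℝ) 1) : PMF Bool :=
  PMF.ofFintype (fun b => if b then ENNReal.ofReal p else ENNReal.ofReal (1 - p)) (by
    rw [Fintype.sum_bool, if_pos rfl, if_neg (by decide),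
      ← ENNReal.ofReal_add hp.1.le (sub_nonneg.2 hp.2.le)]
    simp)

/-- The law of the random series-parallel network of size `n` in the Bernoulli model: start with
a single edge; in each step choose one of the present edges uniformly at random and, independently,
double it in a parallel way with probability `p` and in a serial way with probability `1 - p`. -/
noncomputable def bernoulliNetwork (p : ℝ) (hp : p ∈ Set.Ioo (0 : ℝ) 1) : (n : ℕ) → PMF (Network n)
  | 0 => PMF.pure Network.empty
  | 1 => PMF.pure Network.single
  | n + 2 =>
    (bernoulliNetwork p hp (n + 1)).bind fun G =>
      (PMF.uniformOfFintype (Fin (n + 1))).bind fun j =>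
        (biasedCoin p hp).map fun b => if b then G.parallel j else G.serial j

/-- The expected number of source-to-sink paths in the random network of size `n`. -/
noncomputable def expectedPaths (p : ℝ) (hp : p ∈ Set.Ioo (0 : ℝ) 1) (n : ℕ) : ℝ :=
  ∫ G, (G.numPaths : ℝ) ∂(bernoulliNetwork p hp n).toMeasure

/-- The harmonic number of order `m`, the sum of `1 / j ^ m` over `1 ≤ j ≤ n`. -/
noncomputable def harmonicNumber (m n : ℕ) : ℝ :=
  ∑ j ∈ Finset.Icc 1 n, 1 / (j : ℝ) ^ m

/-- The value `B_k(x 1, …, x k)` of the `k`-th complete Bell polynomial, which is defined through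
the exponential generating function `∑ B_k t ^ k / k! = exp (∑ x_i t ^ i / i!)`, `i ≥ 1`. -/
noncomputable def completeBell (k : ℕ) (x : ℕ → ℝ) : ℝ :=
  (k.factorial : ℝ) * PowerSeries.coeff k
    ((PowerSeries.exp ℝ).subst
      (PowerSeries.mk fun i => if i = 0 then (0 : ℝ) else x i / (i.factorial : ℝ)))

/-- The growth rate away from `p = 1 / 2`. -/
noncomputable def growthFormula (p : ℝ) : ℝ :=
  1 / (1 - (p / (1 - p)) ^ (1 / (1 - 2 * p)))

/-- The growth rate `α_p`. -/
noncomputable def growthRate (p : ℝ) : ℝ :=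
  if p = 1 / 2 then 1 / (1 - Real.exp (-2)) else growthFormula p

/-- The remainder `R_p(n)`, the expectation minus its main term. -/
noncomputable def remainder (p : ℝ) (hp : p ∈ Set.Ioo (0 : ℝ) 1) (n : ℕ) : ℝ :=
  expectedPaths p hp n - 1 / (1 - p) * growthRate p ^ n

/-! Counting source-to-sink paths by length makes the recursion close. Parallel doubling of `j`
duplicates each path through `j`; serial doubling makes each such path one edge longer. Summed over
`j`, a path is counted as often as it has edges, which is the operator `X * d/dX` on `pathPoly`.
Hence the mean path polynomials satisfy a linear recursion (`meanPathPoly_succ`), although the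
expected number of paths alone does not.

For the bivariate generating function, with `v` marking the path length, the recursion is a
first-order linear partial differential equation. Its solution is `v / (W + (1 - p) v Y)`
(`mk_meanPathPoly_mul`), where `Y` solves a linear ordinary equation and `W = 1 - z - (1 - 2p) Y`.
At `v = 1` this gives `∑ E(P_{n+1}) z^n = 1 / (1 - z + p Y)` with `Y = ((1 - z) - (1 - z)^(2p)) / (1
- 2p)`, or `Y = (1 - z) log (1 - z)` if `p = 1/2`. Splitting off the factor `1 - z` of the
denominator and expanding a geometric series yields the explicit formulas.

For the asymptotics put `w = 1 - z`. On the slit plane the denominator `U(w)` has exactly one zero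
`w₀`; it lies in `(0, 1)`, and the differential equation forces `U'(w₀) = 1 - p`. This pole
contributes exactly `α_p^n / (1 - p)` with `α_p = 1 / (1 - w₀)`. The rest is holomorphic on the slit
plane (`exists_remainder_function`), so its coefficients are governed by `w = 0` through the
transfer bound `exists_norm_coeff_taylorSeries_le`. If `p ≠ 1/2`, then `U = A w^s + B w^t` with `s <
t`, and `1/U = w^(-s)/A + O(w^(t-2s))`. If `p = 1/2`, then `1/U = 2 / (w (2 + log w))` is compared
with `-2 / (w log n)`, since the scale `|w| ≈ 1/n` is decisive; for this the transfer bound has to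
be uniform in the function. -/

namespace Network

/-! ### Paths and their length polynomial -/

section Paths

variable {n : ℕ}

theorem IsSourceSinkPath.nodup {G : Network n} {l : List (Fin n)} (h : G.IsSourceSinkPath l) :
    l.Nodup :=
  (List.nodup_cons.1 h.2).2.of_map _

theorem finite_setOf_isSourceSinkPath (G : Network n) :
    {l : List (Fin n) | G.IsSourceSinkPath l}.Finite := by
  refine (List.finite_length_le (Fin n) n).subset fun l hl => ?_
  simpa using (IsSourceSinkPath.nodup hl).length_le_card

/-- The finite set of source-to-sink paths. -/
noncomputable def paths (G : Network n) : Finset (List (Fin n)) :=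
  G.finite_setOf_isSourceSinkPath.toFinset

theorem mem_paths {G : Network n} {l : List (Fin n)} : l ∈ G.paths ↔ G.IsSourceSinkPath l := by
  simp [paths]

theorem numPaths_eq_card (G : Network n) : G.numPaths = G.paths.card :=
  Set.ncard_eq_toFinset_card _ G.finite_setOf_isSourceSinkPath

/-- The generating polynomial of the source-to-sink paths, counted by their lengths. -/
noncomputable def pathPoly (G : Network n) : Polynomial ℝ :=
  ∑ l ∈ G.paths, Polynomial.X ^ l.length

theorem eval_one_pathPoly (G : Network n) : G.pathPoly.eval 1 = G.numPaths := by
  simp [pathPoly, numPaths_eq_card, Polynomial.eval_finsetSum]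

/-- Double counting of incidences between edges and paths: a path repeats no edge, so it passes
through exactly as many edges as its length. The weight `f` is free so that both kinds of doubling
can use this. -/
theorem sum_paths_through (G : Network n) (f : ℕ → Polynomial ℝ) :
    ∑ j : Fin n, ∑ l ∈ G.paths with j ∈ l, f l.length =
      ∑ l ∈ G.paths, (l.length : Polynomial ℝ) * f l.length := by
  classical
  simp_rw [Finset.sum_filter]
  rw [Finset.sum_comm]
  refine Finset.sum_congr rfl fun l hl => ?_
  rw [← Finset.sum_filter, Finset.sum_const, nsmul_eq_mul]
  congr 2
  rw [← List.toFinset_card_of_nodup (mem_paths.1 hl).nodup]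
  congr 1
  ext j
  simp

theorem X_mul_derivative_pathPoly (G : Network n) :
    Polynomial.X * G.pathPoly.derivative =
      ∑ l ∈ G.paths, (l.length : Polynomial ℝ) * Polynomial.X ^ l.length := by
  simp only [pathPoly, Polynomial.derivative_sum, Finset.mul_sum]
  refine Finset.sum_congr rfl fun l _ => ?_
  rcases l.length with _ | k
  · simp
  · rw [Polynomial.derivative_X_pow, Nat.add_sub_cancel, Polynomial.C_eq_natCast]
    ring

end Paths

/-! ### Parallel doubling -/

section Parallel

variable {n : ℕ}

/-- Forget which one of the two parallel edges created by doubling `j` is used. -/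
def mergeEdge (j : Fin n) : Fin (n + 1) → Fin n :=
  Fin.snoc (α := fun _ => Fin n) id j

@[simp] theorem mergeEdge_castSucc (j e : Fin n) : mergeEdge j e.castSucc = e := by
  simp [mergeEdge]

@[simp] theorem mergeEdge_last (j : Fin n) : mergeEdge j (Fin.last n) = j := by
  simp [mergeEdge]

theorem parallel_tail (G : Network n) (j : Fin n) (e : Fin (n + 1)) :
    (G.parallel j).tail e = G.tail (mergeEdge j e) := by
  induction e using Fin.lastCases <;> simp [parallel]

theorem parallel_head (G : Network n) (j : Fin n) (e : Fin (n + 1)) :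
    (G.parallel j).head e = G.head (mergeEdge j e) := by
  induction e using Fin.lastCases <;> simp [parallel]

theorem parallel_isWalk (G : Network n) (j : Fin n) (u v : ℕ) (l : List (Fin (n + 1))) :
    (G.parallel j).IsWalk u l v ↔ G.IsWalk u (l.map (mergeEdge j)) v := by
  induction l generalizing u with
  | nil => rfl
  | cons e l ih => simp [IsWalk, ih, parallel_tail, parallel_head]

theorem parallel_isSourceSinkPath (G : Network n) (j : Fin n) (l : List (Fin (n + 1))) :
    (G.parallel j).IsSourceSinkPath l ↔ G.IsSourceSinkPath (l.map (mergeEdge j)) := by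
  have : l.map (G.parallel j).head = (l.map (mergeEdge j)).map G.head := by
    simp [parallel_head, Function.comp_def]
  rw [IsSourceSinkPath, IsSourceSinkPath, parallel_isWalk, this]

/-- Use the new one of the two parallel edges created by doubling `j`. -/
def switchEdge (j e : Fin n) : Fin (n + 1) :=
  if e = j then Fin.last n else e.castSucc

theorem mergeEdge_switchEdge (j e : Fin n) : mergeEdge j (switchEdge j e) = e := by
  unfold switchEdge
  split_ifs with h <;> simp [h]

/-- A path enters a node at most once, so it uses at most one of two parallel edges. Those avoiding
the new edge are old paths; those using it are old paths through `j` with `j` exchanged. -/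
theorem paths_parallel (G : Network n) (j : Fin n) :
    (G.parallel j).paths = G.paths.image (List.map Fin.castSucc) ∪
      (G.paths.filter (j ∈ ·)).image (List.map (switchEdge j)) := by
  ext l
  simp only [Finset.mem_union, Finset.mem_image, Finset.mem_filter, mem_paths]
  constructor
  · intro h
    rw [parallel_isSourceSinkPath] at h
    -- The merged list has no repetition, so `l` cannot contain both `j` and its new twin.
    have hinj := List.inj_on_of_nodup_map h.nodup
    by_cases hl : Fin.last n ∈ l
    · refine Or.inr ⟨_, ⟨h, List.mem_map.2 ⟨_, hl, mergeEdge_last j⟩⟩, ?_⟩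
      rw [List.map_map]
      conv_rhs => rw [← List.map_id l]
      refine List.map_congr_left fun e he => ?_
      induction e using Fin.lastCases with
      | last => simp [switchEdge]
      | cast e =>
        have : e ≠ j := by
          rintro rfl
          have := hinj he hl (by simp)
          exact Fin.castSucc_ne_last _ this
        simp [switchEdge, this]
    · refine Or.inl ⟨_, h, ?_⟩
      rw [List.map_map]
      conv_rhs => rw [← List.map_id l]
      refine List.map_congr_left fun e he => ?_
      induction e using Fin.lastCases with
      | last => exact absurd he hl
      | cast e => simp
  · rintro (⟨l, hl, rfl⟩ | ⟨l, ⟨hl, -⟩, rfl⟩) <;> rw [parallel_isSourceSinkPath, List.map_map]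
    · convert hl
      conv_rhs => rw [← List.map_id l]
      exact List.map_congr_left fun e _ => by simp
    · convert hl
      conv_rhs => rw [← List.map_id l]
      exact List.map_congr_left fun e _ => by simp [mergeEdge_switchEdge]

theorem pathPoly_parallel (G : Network n) (j : Fin n) :
    (G.parallel j).pathPoly =
      G.pathPoly + ∑ l ∈ G.paths with j ∈ l, Polynomial.X ^ l.length := by
  classical
  rw [pathPoly, paths_parallel, Finset.sum_union, Finset.sum_image, Finset.sum_image]
  · simp [pathPoly]
  · refine (List.map_injective_iff.2 ?_).injOn
    exact Function.LeftInverse.injective (mergeEdge_switchEdge j)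
  · exact (List.map_injective_iff.2 (Fin.castSucc_injective n)).injOn
  · rw [Finset.disjoint_left]
    simp only [Finset.mem_image, Finset.mem_filter, not_exists, not_and]
    rintro _ ⟨l, -, rfl⟩ l' ⟨-, hj⟩ h
    have : Fin.last n ∈ l.map Fin.castSucc := by
      rw [← h]
      exact List.mem_map.2 ⟨j, hj, by simp [switchEdge]⟩
    obtain ⟨e, -, he⟩ := List.mem_map.1 this
    exact Fin.castSucc_ne_last _ he

end Parallel

/-! ### Serial doubling -/

section Serial

variable {n : ℕ}

/-- All nodes are among `0, …, n`. -/
def NodesLE (G : Network n) : Prop :=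
  ∀ e, G.tail e ≤ n ∧ G.head e ≤ n

theorem nodesLE_single : single.NodesLE := fun _ => by simp [single]

theorem NodesLE.parallel {G : Network n} (h : G.NodesLE) (j : Fin n) : (G.parallel j).NodesLE :=
  fun e => by
    rw [parallel_tail, parallel_head]
    exact ⟨(h _).1.trans n.le_succ, (h _).2.trans n.le_succ⟩

@[simp] theorem serial_tail_castSucc (G : Network n) (j e : Fin n) :
    (G.serial j).tail e.castSucc = G.tail e := by simp [serial]

@[simp] theorem serial_tail_last (G : Network n) (j : Fin n) :
    (G.serial j).tail (Fin.last n) = n + 1 := by simp [serial]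

@[simp] theorem serial_head_last (G : Network n) (j : Fin n) :
    (G.serial j).head (Fin.last n) = G.head j :=
  Fin.snoc_last (α := fun _ => ℕ) _ _

@[simp] theorem serial_head_castSucc_self (G : Network n) (j : Fin n) :
    (G.serial j).head j.castSucc = n + 1 := by simp [serial]

theorem serial_head_castSucc_of_ne (G : Network n) {j e : Fin n} (h : e ≠ j) :
    (G.serial j).head e.castSucc = G.head e := by simp [serial, h]

theorem NodesLE.serial {G : Network n} (h : G.NodesLE) (j : Fin n) : (G.serial j).NodesLE := by
  intro e
  induction e using Fin.lastCases with
  | last => simpa using (h j).2.trans n.le_succ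
  | cast e =>
    by_cases he : e = j
    · subst he
      simpa using (h e).1.trans n.le_succ
    · rw [serial_head_castSucc_of_ne G he, serial_tail_castSucc]
      exact ⟨(h _).1.trans n.le_succ, (h _).2.trans n.le_succ⟩

/-- Replace the edge `j` by the two edges which the serial doubling creates. -/
def splitEdge (j : Fin n) (l : List (Fin n)) : List (Fin (n + 1)) :=
  l.flatMap fun e => if e = j then [e.castSucc, Fin.last n] else [e.castSucc]

@[simp] theorem splitEdge_nil (j : Fin n) : splitEdge j [] = [] := rfl

theorem splitEdge_cons_self (j : Fin n) (l : List (Fin n)) :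
    splitEdge j (j :: l) = j.castSucc :: Fin.last n :: splitEdge j l := by
  simp [splitEdge]

theorem splitEdge_cons_of_ne {j e : Fin n} (h : e ≠ j) (l : List (Fin n)) :
    splitEdge j (e :: l) = e.castSucc :: splitEdge j l := by
  simp [splitEdge, h]

theorem splitEdge_injective (j : Fin n) : Function.Injective (splitEdge j) := by
  refine Function.LeftInverse.injective
    (g := List.filterMap (Fin.snoc (α := fun _ => Option (Fin n)) some none)) fun l => ?_
  induction l with
  | nil => rfl
  | cons e l ih =>
    by_cases he : e = j
    · subst he
      simp [splitEdge_cons_self, ih]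
    · simp [splitEdge_cons_of_ne he, ih]

theorem length_splitEdge (j : Fin n) (l : List (Fin n)) :
    (splitEdge j l).length = l.length + l.count j := by
  induction l with
  | nil => rfl
  | cons e l ih =>
    by_cases he : e = j
    · subst he
      simp [splitEdge_cons_self, ih]
      omega
    · simp [splitEdge_cons_of_ne he, ih, List.count_cons_of_ne he]
      omega

theorem IsWalk.splitEdge {G : Network n} (j : Fin n) {u v : ℕ} {l : List (Fin n)}
    (h : G.IsWalk u l v) : (G.serial j).IsWalk u (splitEdge j l) v := by
  induction l generalizing u with
  | nil => exact h
  | cons e l ih =>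
    by_cases he : e = j
    · subst he
      simpa [splitEdge_cons_self, IsWalk, h.1] using ih h.2
    · simpa [splitEdge_cons_of_ne he, IsWalk, h.1, serial_head_castSucc_of_ne G he] using ih h.2

/-- The new node `n + 1` is entered only by `j` and left only by the new edge. A walk that neither
starts nor ends there must therefore use these two edges consecutively. -/
theorem exists_eq_splitEdge {G : Network n} (hG : G.NodesLE) (j : Fin n) {v : ℕ} (hv : v ≤ n) :
    ∀ (L : List (Fin (n + 1))) {u : ℕ}, u ≤ n → (G.serial j).IsWalk u L v →
      ∃ l, G.IsWalk u l v ∧ L = splitEdge j l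
  | [], u, _, h => ⟨[], h, rfl⟩
  | e :: L, u, hu, h => by
    induction e using Fin.lastCases with
    | last =>
      have := h.1
      simp at this
      omega
    | cast e =>
      have h1 : G.tail e = u := by simpa using h.1
      have h2 := h.2
      by_cases he : e = j
      · subst he
        rw [serial_head_castSucc_self] at h2
        match L, h2 with
        | [], h2 =>
          have : n + 1 = v := h2
          omega
        | f :: L, h2 =>
          induction f using Fin.lastCases with
          | last =>
            have h3 := h2.2
            rw [serial_head_last] at h3
            obtain ⟨l, hl, rfl⟩ := exists_eq_splitEdge hG e hv L (hG e).2 h3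
            exact ⟨e :: l, ⟨h1, hl⟩, (splitEdge_cons_self e l).symm⟩
          | cast f =>
            have h3 := h2.1
            rw [serial_tail_castSucc] at h3
            have := (hG f).1
            omega
      · rw [serial_head_castSucc_of_ne G he] at h2
        obtain ⟨l, hl, rfl⟩ := exists_eq_splitEdge hG j hv L (hG e).2 h2
        exact ⟨e :: l, ⟨h1, hl⟩, (splitEdge_cons_of_ne he l).symm⟩

/-- Splitting only inserts the new node among the visited ones; thus simplicity of the split walk
passes to the original walk. -/
theorem map_head_sublist (G : Network n) (j : Fin n) (l : List (Fin n)) :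
    (l.map G.head).Sublist ((splitEdge j l).map (G.serial j).head) := by
  induction l with
  | nil => simp
  | cons e l ih =>
    by_cases he : e = j
    · subst he
      simpa [splitEdge_cons_self] using (ih.cons_cons _).cons _
    · simpa [splitEdge_cons_of_ne he, serial_head_castSucc_of_ne G he] using ih

theorem mem_map_head_splitEdge {G : Network n} {j : Fin n} {l : List (Fin n)} {x : ℕ}
    (h : x ∈ (splitEdge j l).map (G.serial j).head) :
    x ∈ l.map G.head ∨ (x = n + 1 ∧ j ∈ l) := by
  induction l with
  | nil => simp at h
  | cons e l ih =>
    by_cases he : e = j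
    · subst he
      rw [splitEdge_cons_self, List.map_cons, List.map_cons, List.mem_cons, List.mem_cons,
        serial_head_castSucc_self, serial_head_last] at h
      rcases h with h | h | h
      · simp [h]
      · simp [h]
      · rcases ih h with h | h
        · left
          rw [List.map_cons]
          exact List.mem_cons_of_mem _ h
        · simp [h.1]
    · rw [splitEdge_cons_of_ne he, List.map_cons, List.mem_cons,
        serial_head_castSucc_of_ne G he] at h
      rcases h with h | h
      · simp [h]
      · rcases ih h with h | h
        · left
          rw [List.map_cons]
          exact List.mem_cons_of_mem _ h
        · exact Or.inr ⟨h.1, List.mem_cons_of_mem _ h.2⟩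

theorem nodup_map_head_splitEdge {G : Network n} (hG : G.NodesLE) (j : Fin n) {l : List (Fin n)}
    (h : (l.map G.head).Nodup) : ((splitEdge j l).map (G.serial j).head).Nodup := by
  induction l with
  | nil => simp
  | cons e l ih =>
    rw [List.map_cons, List.nodup_cons] at h
    have hz : G.head e ≠ n + 1 := by have := (hG e).2; omega
    have key : G.head e ∉ (splitEdge j l).map (G.serial j).head := fun hm => by
      rcases mem_map_head_splitEdge hm with h' | h'
      · exact h.1 h'
      · exact hz h'.1
    by_cases he : e = j
    · subst he
      rw [splitEdge_cons_self, List.map_cons, List.map_cons, List.nodup_cons, List.nodup_cons,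
        serial_head_castSucc_self, serial_head_last, List.mem_cons, not_or]
      refine ⟨⟨hz.symm, fun hm => ?_⟩, key, ih h.2⟩
      rcases mem_map_head_splitEdge hm with h' | h'
      · obtain ⟨f, -, hf⟩ := List.mem_map.1 h'
        have := (hG f).2
        omega
      -- A second visit of the new node would mean a second use of the edge, hence a repeated head.
      · exact h.1 (List.mem_map_of_mem h'.2)
    · rw [splitEdge_cons_of_ne he, List.map_cons, List.nodup_cons,
        serial_head_castSucc_of_ne G he]
      exact ⟨key, ih h.2⟩

theorem paths_serial {G : Network n} (hG : G.NodesLE) (j : Fin n) :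
    (G.serial j).paths = G.paths.image (splitEdge j) := by
  ext L
  simp only [Finset.mem_image, mem_paths]
  constructor
  · intro h
    -- This keeps the sink `1` apart from the new node `n + 1`.
    have : 1 ≤ n := by have := j.2; omega
    obtain ⟨l, hl, rfl⟩ := exists_eq_splitEdge hG j this L (Nat.zero_le n) h.1
    exact ⟨l, ⟨hl, h.2.sublist ((map_head_sublist G j l).cons_cons _)⟩, rfl⟩
  · rintro ⟨l, hl, rfl⟩
    refine ⟨hl.1.splitEdge j, List.nodup_cons.2 ⟨fun hm => ?_,
      nodup_map_head_splitEdge hG j (List.nodup_cons.1 hl.2).2⟩⟩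
    rcases mem_map_head_splitEdge hm with h | h
    · exact (List.nodup_cons.1 hl.2).1 h
    · omega

/-- A path through `j` uses it once and becomes one edge longer, which changes its monomial by
`X^(k+1) - X^k`. -/
theorem pathPoly_serial {G : Network n} (hG : G.NodesLE) (j : Fin n) :
    (G.serial j).pathPoly = G.pathPoly +
      ∑ l ∈ G.paths with j ∈ l, (Polynomial.X - 1) * Polynomial.X ^ l.length := by
  classical
  rw [pathPoly, paths_serial hG, Finset.sum_image (splitEdge_injective j).injOn, pathPoly,
    Finset.sum_filter, ← Finset.sum_add_distrib]
  refine Finset.sum_congr rfl fun l hl => ?_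
  rw [length_splitEdge]
  split_ifs with h
  · rw [List.count_eq_one_of_mem (mem_paths.1 hl).nodup h]
    ring
  · simp [List.count_eq_zero_of_not_mem h]

end Serial

theorem pathPoly_single : single.pathPoly = Polynomial.X := by
  have : single.paths = {[0]} := by
    ext l
    rw [mem_paths, Finset.mem_singleton]
    constructor
    · intro h
      have h1 := h.nodup.length_le_card
      match l, h, h1 with
      | [], h, _ => exact absurd h.1 (by simp [IsWalk])
      | [e], _, _ => rw [Subsingleton.elim e 0]
      | _ :: _ :: _, _, h1 => simp at h1
    · rintro rfl
      simp [IsSourceSinkPath, IsWalk, single]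
  simp [pathPoly, this]

theorem sum_pathPoly_parallel {n : ℕ} (G : Network n) :
    ∑ j, (G.parallel j).pathPoly =
      (n : Polynomial ℝ) * G.pathPoly + Polynomial.X * G.pathPoly.derivative := by
  simp_rw [pathPoly_parallel]
  rw [Finset.sum_add_distrib, sum_paths_through, X_mul_derivative_pathPoly]
  simp

theorem sum_pathPoly_serial {n : ℕ} {G : Network n} (hG : G.NodesLE) :
    ∑ j, (G.serial j).pathPoly =
      (n : Polynomial ℝ) * G.pathPoly + (Polynomial.X - 1) * (Polynomial.X * G.pathPoly.derivative) := by
  simp_rw [pathPoly_serial hG]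
  rw [Finset.sum_add_distrib, sum_paths_through G fun k => (Polynomial.X - 1) * Polynomial.X ^ k,
    X_mul_derivative_pathPoly, Finset.mul_sum]
  simp [mul_left_comm]

end Network

/-! ### Means under finitely supported laws -/

section Mean

variable {α β M : Type*} [AddCommGroup M] [Module ℝ M]

/-- The mean of a function with values in a real vector space under a finitely supported law. -/
noncomputable def pmfMean (μ : PMF α) (f : α → M) : M := ∑ᶠ a, (μ a).toReal • f a

theorem pmfMean_eq_sum {μ : PMF α} (f : α → M) {s : Finset α} (hs : μ.support ⊆ s) :
    pmfMean μ f = ∑ a ∈ s, (μ a).toReal • f a := by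
  refine finsum_eq_sum_of_support_subset _ fun a ha => hs ?_
  rw [PMF.mem_support_iff]
  rintro h
  simp [h] at ha

theorem PMF.finite_support_bind {μ : PMF α} {κ : α → PMF β} (hμ : μ.support.Finite)
    (hκ : ∀ a, (κ a).support.Finite) : (μ.bind κ).support.Finite := by
  rw [PMF.support_bind]
  exact hμ.biUnion fun a _ => hκ a

theorem pmfMean_bind {μ : PMF α} {κ : α → PMF β} (hμ : μ.support.Finite)
    (hκ : ∀ a, (κ a).support.Finite) (f : β → M) :
    pmfMean (μ.bind κ) f = pmfMean μ fun a => pmfMean (κ a) f := by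
  classical
  set s := hμ.toFinset
  have hs : μ.support ⊆ s := by simp [s]
  set t := s.biUnion fun a => (hκ a).toFinset
  have ht : ∀ a ∈ s, (κ a).support ⊆ t := fun a ha b hb => by
    simp only [t, Finset.coe_biUnion, Set.mem_iUnion]
    exact ⟨a, ha, by simpa using hb⟩
  have hb : (μ.bind κ).support ⊆ t := by
    rw [PMF.support_bind]
    exact Set.iUnion₂_subset fun a ha => ht a (hs ha)
  rw [pmfMean_eq_sum f hb, pmfMean_eq_sum _ hs]
  have : ∀ a ∈ s, (μ a).toReal • pmfMean (κ a) f =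
      ∑ b ∈ t, ((μ a).toReal * (κ a b).toReal) • f b := fun a ha => by
    rw [pmfMean_eq_sum f (ht a ha), Finset.smul_sum]
    simp_rw [smul_smul]
  rw [Finset.sum_congr rfl this, Finset.sum_comm]
  refine Finset.sum_congr rfl fun b _ => ?_
  rw [← Finset.sum_smul]
  congr 1
  rw [PMF.bind_apply, tsum_eq_sum (s := s), ENNReal.toReal_sum]
  · simp
  · intro a _
    exact ENNReal.mul_ne_top (PMF.apply_ne_top _ _) (PMF.apply_ne_top _ _)
  · intro a ha
    have : μ a = 0 := by
      by_contra h
      exact ha (hs ((PMF.mem_support_iff _ _).2 h))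
    simp [this]

theorem pmfMean_pure (a : α) (f : α → M) : pmfMean (PMF.pure a) f = f a := by
  rw [pmfMean_eq_sum (s := {a}) f (by simp)]
  simp

theorem pmfMean_uniformOfFintype [Fintype α] [Nonempty α] (f : α → M) :
    pmfMean (PMF.uniformOfFintype α) f = (Fintype.card α : ℝ)⁻¹ • ∑ a, f a := by
  rw [pmfMean_eq_sum (s := Finset.univ) f (by simp), Finset.smul_sum]
  simp

theorem pmfMean_biasedCoin {p : ℝ} (hp : p ∈ Set.Ioo (0 : ℝ) 1) (f : Bool → M) :
    pmfMean (biasedCoin p hp) f = p • f true + (1 - p) • f false := by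
  rw [pmfMean_eq_sum (s := Finset.univ) f (fun b _ => Finset.mem_coe.2 (Finset.mem_univ b))]
  simp [biasedCoin, ENNReal.toReal_ofReal hp.1.le, ENNReal.toReal_ofReal (sub_nonneg.2 hp.2.le)]

theorem pmfMean_map {μ : PMF α} (hμ : μ.support.Finite) (g : α → β) (f : β → M) :
    pmfMean (μ.map g) f = pmfMean μ (f ∘ g) := by
  rw [PMF.map, pmfMean_bind hμ (fun a => by simp)]
  simp [pmfMean_pure, Function.comp_def]

theorem pmfMean_congr {μ : PMF α} {f g : α → M} (h : ∀ a ∈ μ.support, f a = g a) :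
    pmfMean μ f = pmfMean μ g := by
  refine finsum_congr fun a => ?_
  by_cases ha : μ a = 0
  · simp [ha]
  · rw [h a ((PMF.mem_support_iff _ _).2 ha)]

theorem map_pmfMean {N : Type*} [AddCommGroup N] [Module ℝ N] {μ : PMF α} (hμ : μ.support.Finite)
    (T : M →ₗ[ℝ] N) (f : α → M) : T (pmfMean μ f) = pmfMean μ fun a => T (f a) := by
  have hs : μ.support ⊆ hμ.toFinset := by simp
  rw [pmfMean_eq_sum f hs, pmfMean_eq_sum _ hs, map_sum]
  simp

variable [MeasurableSpace α] [MeasurableSingletonClass α]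

theorem PMF.integrable_of_finite_support {μ : PMF α} (hμ : μ.support.Finite) (f : α → ℝ) :
    Integrable f μ.toMeasure := by
  rw [← PMF.restrict_toMeasure_support μ, ← hμ.coe_toFinset]
  exact IntegrableOn.finset

theorem PMF.integral_eq_pmfMean {μ : PMF α} (hμ : μ.support.Finite) (f : α → ℝ) :
    ∫ a, f a ∂μ.toMeasure = pmfMean μ f := by
  rw [PMF.integral_eq_tsum _ _ (PMF.integrable_of_finite_support hμ f),
    pmfMean_eq_sum f (s := hμ.toFinset) (by simp), tsum_eq_sum]
  intro a ha
  have : μ a = 0 := by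
    by_contra h
    exact ha (by simpa using h)
  simp [this]

end Mean

instance (n : ℕ) : DiscreteMeasurableSpace (Network n) := ⟨fun _ => trivial⟩

/-! ### Recursion for the mean path polynomial -/

section Growth

open Polynomial

variable {p : ℝ} (hp : p ∈ Set.Ioo (0 : ℝ) 1)

theorem finite_support_bernoulliNetwork : ∀ n, (bernoulliNetwork p hp n).support.Finite
  | 0 => by simp [bernoulliNetwork]
  | 1 => by simp [bernoulliNetwork]
  | n + 2 => by
    rw [bernoulliNetwork]
    exact PMF.finite_support_bind (finite_support_bernoulliNetwork (n + 1)) fun G =>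
      PMF.finite_support_bind (Set.toFinite _) fun j => by
        rw [PMF.support_map]
        exact (Set.toFinite _).image _

/-- This guarantees that the node created by a serial doubling is indeed new. -/
theorem nodesLE_of_mem_support : ∀ n, ∀ G ∈ (bernoulliNetwork p hp (n + 1)).support, G.NodesLE
  | 0, G, h => by
    simp [bernoulliNetwork] at h
    exact h ▸ Network.nodesLE_single
  | n + 1, G, h => by
    rw [bernoulliNetwork, PMF.support_bind] at h
    simp only [Set.mem_iUnion, PMF.support_bind, PMF.support_map] at h
    obtain ⟨G', hG', j, -, b, -, rfl⟩ := h
    have := nodesLE_of_mem_support n G' hG'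
    dsimp only
    split_ifs
    · exact this.parallel j
    · exact this.serial j

/-- The mean of the path-length polynomial of the random network of size `n + 1`. -/
noncomputable def meanPathPoly (n : ℕ) : ℝ[X] :=
  pmfMean (bernoulliNetwork p hp (n + 1)) Network.pathPoly

theorem meanPathPoly_zero : meanPathPoly hp 0 = X := by
  rw [meanPathPoly, bernoulliNetwork, pmfMean_pure, Network.pathPoly_single]

/-- The increments `X f'` (parallel) and `(X - 1) X f'` (serial), weighted by `p` and `1 - p`, add
up to `X ((1 - p) X + 2p - 1) f'`; the uniform choice among `n + 1` edges divides by `n + 1`. The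
step is linear in `f`, so it commutes with the mean. -/
theorem meanPathPoly_succ (n : ℕ) :
    meanPathPoly hp (n + 1) = meanPathPoly hp n +
      ((n : ℝ) + 1)⁻¹ • (X * ((1 - p) • X + C (2 * p - 1)) * (meanPathPoly hp n).derivative) := by
  have hfin := finite_support_bernoulliNetwork hp (n + 1)
  let T : ℝ[X] →ₗ[ℝ] ℝ[X] := LinearMap.id + ((n : ℝ) + 1)⁻¹ •
    (LinearMap.mulLeft ℝ (X * ((1 - p) • X + C (2 * p - 1))) ∘ₗ Polynomial.derivative)
  have hT : ∀ f, T f = f +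
      ((n : ℝ) + 1)⁻¹ • (X * ((1 - p) • X + C (2 * p - 1)) * derivative f) := fun f => rfl
  rw [← hT, meanPathPoly, meanPathPoly, map_pmfMean hfin, bernoulliNetwork, pmfMean_bind hfin]
  · refine pmfMean_congr fun G hG => ?_
    have hn : (n : ℝ) + 1 ≠ 0 := by positivity
    rw [pmfMean_bind (Set.toFinite _), pmfMean_uniformOfFintype]
    · simp_rw [pmfMean_map (Set.toFinite (biasedCoin p hp).support), pmfMean_biasedCoin]
      simp only [Function.comp, if_true, Bool.false_eq_true, if_false]
      rw [Finset.sum_add_distrib, ← Finset.smul_sum, ← Finset.smul_sum,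
        Network.sum_pathPoly_parallel, Network.sum_pathPoly_serial
          (nodesLE_of_mem_support hp n G hG), hT]
      have h1 : G.pathPoly = ((n : ℝ) + 1)⁻¹ • (((n : ℝ) + 1) • G.pathPoly) := by
        rw [smul_smul, inv_mul_cancel₀ hn, one_smul]
      conv_rhs => enter [1]; rw [h1]
      rw [← smul_add, Fintype.card_fin]
      push_cast
      congr 1
      simp only [smul_eq_C_mul, map_sub, map_add, map_mul, map_one, map_natCast, map_ofNat]
      ring
    · intro j
      rw [PMF.support_map]
      exact (Set.toFinite _).image _
  · exact fun G => PMF.finite_support_bind (Set.toFinite _) fun j => by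
      rw [PMF.support_map]
      exact (Set.toFinite _).image _

theorem expectedPaths_succ (n : ℕ) :
    expectedPaths p hp (n + 1) = (meanPathPoly hp n).eval 1 := by
  have hfin := finite_support_bernoulliNetwork hp (n + 1)
  rw [expectedPaths, PMF.integral_eq_pmfMean hfin, meanPathPoly]
  have := map_pmfMean hfin (Polynomial.leval (1 : ℝ)) Network.pathPoly
  simp only [Polynomial.leval_apply] at this
  rw [this]
  simp_rw [Network.eval_one_pathPoly]

end Growth

/-! ### The generating function in closed form -/

section GeneratingFunction

open PowerSeries

/-- The power series solution `Y` with `Y 0 = 0` of the differential equation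
`(1 - z) Y' = -2 p Y - (1 - z)`. -/
structure IsGrowthSeries {K : Type*} [Field K] (p : K) (Y : K⟦X⟧) : Prop where
  constantCoeff_eq : constantCoeff Y = 0
  ode : (1 - X) * derivative K Y = -(C (2 * p) * Y) - (1 - X)

theorem coeff_one_sub_X_mul_derivative {R : Type*} [CommRing R] (f : R⟦X⟧) (m : ℕ) :
    coeff m ((1 - X) * derivative R f) = (m + 1) * coeff (m + 1) f - m * coeff m f := by
  rw [sub_mul, one_mul, map_sub, coeff_derivative]
  rcases m with _ | m
  · simp [mul_comm]
  · rw [coeff_succ_X_mul, coeff_derivative]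
    push_cast
    ring

theorem derivative_mul {R : Type*} [CommRing R] (f g : R⟦X⟧) :
    derivative R (f * g) = f * derivative R g + g * derivative R f := by
  rw [Derivation.leibniz, smul_eq_mul, smul_eq_mul]

theorem constantCoeff_map_apply {R S : Type*} [CommRing R] [CommRing S] (φ : R →+* S) (f : R⟦X⟧) :
    constantCoeff (PowerSeries.map φ f) = φ (constantCoeff f) := by
  rw [← coeff_zero_eq_constantCoeff_apply, coeff_map, coeff_zero_eq_constantCoeff_apply]

/-- The coefficient of `X^m` in the equation determines the coefficient of `X^(m+1)` in the
solution. Over `ℂ` this identifies the formal solution with the Taylor series of an analytic one. -/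
theorem IsGrowthSeries.unique {K : Type*} [Field K] [CharZero K] {p : K} {Y Z : K⟦X⟧}
    (hY : IsGrowthSeries p Y) (hZ : IsGrowthSeries p Z) : Y = Z := by
  ext m
  induction m with
  | zero => simp [hY.constantCoeff_eq, hZ.constantCoeff_eq]
  | succ m ih =>
    have h1 := congrArg (coeff m) hY.ode
    have h2 := congrArg (coeff m) hZ.ode
    rw [coeff_one_sub_X_mul_derivative, map_sub, map_neg, coeff_C_mul] at h1 h2
    have h3 : ((m : K) + 1) * coeff (m + 1) Y = (m + 1) * coeff (m + 1) Z := by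
      rw [← ih] at h2
      linear_combination h1 - h2
    exact mul_left_cancel₀ (Nat.cast_add_one_ne_zero m) h3

theorem IsGrowthSeries.map {K L : Type*} [Field K] [Field L] (φ : K →+* L) {p : K} {Y : K⟦X⟧}
    (hY : IsGrowthSeries p Y) : IsGrowthSeries (φ p) (PowerSeries.map φ Y) := by
  refine ⟨?_, ?_⟩
  · rw [constantCoeff_map_apply, hY.constantCoeff_eq, map_zero]
  · ext m
    have h := congrArg (coeff m) hY.ode
    rw [coeff_one_sub_X_mul_derivative, map_sub, map_neg, coeff_C_mul] at h ⊢
    replace h := congrArg φ h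
    have h1 : coeff m (1 - X : L⟦X⟧) = φ (coeff m (1 - X : K⟦X⟧)) := by
      rw [← coeff_map]
      simp
    rw [h1]
    have h2 : φ 2 = 2 := map_ofNat φ 2
    simpa [h2] using h

section CoefficientDerivation

variable (φ : Polynomial ℝ)

/-- The derivation `φ ∂/∂v`, applied to the coefficients of a power series over `ℝ[v]`. -/
noncomputable def coeffDeriv (f : (Polynomial ℝ)⟦X⟧) : (Polynomial ℝ)⟦X⟧ :=
  PowerSeries.mk fun n => φ * Polynomial.derivative (coeff n f)

@[simp] theorem coeff_coeffDeriv (f : (Polynomial ℝ)⟦X⟧) (n : ℕ) :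
    coeff n (coeffDeriv φ f) = φ * Polynomial.derivative (coeff n f) := by
  simp [coeffDeriv]

theorem coeffDeriv_add (f g : (Polynomial ℝ)⟦X⟧) :
    coeffDeriv φ (f + g) = coeffDeriv φ f + coeffDeriv φ g := by
  ext1 n
  simp [mul_add]

theorem coeffDeriv_mul (f g : (Polynomial ℝ)⟦X⟧) :
    coeffDeriv φ (f * g) = coeffDeriv φ f * g + f * coeffDeriv φ g := by
  ext1 n
  simp only [coeff_coeffDeriv, map_add, coeff_mul, Polynomial.derivative_sum, Finset.mul_sum,
    Polynomial.derivative_mul, ← Finset.sum_add_distrib]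
  exact Finset.sum_congr rfl fun x _ => by ring

theorem coeffDeriv_C (a : Polynomial ℝ) :
    coeffDeriv φ (C a) = C (φ * Polynomial.derivative a) := by
  ext1 n
  rw [coeff_coeffDeriv, coeff_C, coeff_C]
  split_ifs <;> simp

theorem coeffDeriv_map_C (f : ℝ⟦X⟧) :
    coeffDeriv φ (PowerSeries.map Polynomial.C f) = 0 := by
  ext1 n
  simp

end CoefficientDerivation

theorem derivative_map {R S : Type*} [CommRing R] [CommRing S] (φ : R →+* S) (f : R⟦X⟧) :
    derivative S (PowerSeries.map φ f) = PowerSeries.map φ (derivative R f) := by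
  ext n
  simp [coeff_derivative]

variable {p : ℝ} (hp : p ∈ Set.Ioo (0 : ℝ) 1)

/-- The recursion says `(1 - z) F_z = F + φ F_v` with `φ = v ψ`, `ψ = (1 - p) v + 2p - 1`. The
proposed denominator satisfies `U + (1 - z) U_z - φ U_v = -ψ U`, so the product `K = F U` satisfies
`(1 - z) K_z = φ K_v - ψ K`. The constant series `v` solves this because `φ = v ψ`, and a solution
is determined by its constant term. -/
theorem mk_meanPathPoly_mul {Y : ℝ⟦X⟧} (hY : IsGrowthSeries p Y) :
    PowerSeries.mk (meanPathPoly hp) * (PowerSeries.map Polynomial.C (1 - X - C (1 - 2 * p) * Y) +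
      C (Polynomial.X * Polynomial.C (1 - p)) * PowerSeries.map Polynomial.C Y) =
      C Polynomial.X := by
  set ψ : Polynomial ℝ := (1 - p) • Polynomial.X + Polynomial.C (2 * p - 1) with hψ
  set φ : Polynomial ℝ := Polynomial.X * ψ with hφ
  set F := PowerSeries.mk (meanPathPoly hp) with hF
  set W : ℝ⟦X⟧ := 1 - X - C (1 - 2 * p) * Y with hW
  set U := PowerSeries.map Polynomial.C W +
    C (Polynomial.X * Polynomial.C (1 - p)) * PowerSeries.map Polynomial.C Y with hU
  have hFode : (1 - X) * derivative _ F = F + coeffDeriv φ F := by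
    ext1 m
    rw [coeff_one_sub_X_mul_derivative, map_add, coeff_coeffDeriv, hF, coeff_mk, coeff_mk,
      meanPathPoly_succ]
    have h1 : ((m : Polynomial ℝ) + 1) * ((m : ℝ) + 1)⁻¹ • (φ * (meanPathPoly hp m).derivative) =
        φ * (meanPathPoly hp m).derivative := by
      have : ((m : Polynomial ℝ) + 1) = Polynomial.C ((m : ℝ) + 1) := by simp
      rw [this, ← Polynomial.smul_eq_C_mul, smul_smul, mul_inv_cancel₀ (by positivity), one_smul]
    rw [mul_add, h1]
    ring
  have hWode : (1 - X) * derivative _ W = -(C (2 * p) * W) := by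
    have h1 : derivative ℝ W = -1 - C (1 - 2 * p) * derivative ℝ Y := by
      simp [hW]
    rw [h1, mul_sub, mul_left_comm, hY.ode, hW]
    simp only [map_sub, map_mul, map_one, map_ofNat]
    ring
  have hUode : U + (1 - X) * derivative _ U - coeffDeriv φ U = -(C ψ * U) := by
    have h1 : coeffDeriv φ U =
        C (φ * Polynomial.C (1 - p)) * PowerSeries.map Polynomial.C Y := by
      rw [hU, coeffDeriv_add, coeffDeriv_map_C, coeffDeriv_mul, coeffDeriv_map_C, coeffDeriv_C]
      simp
    have h2 : (1 - X) * derivative _ U = PowerSeries.map Polynomial.C (-(C (2 * p) * W)) +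
        C (Polynomial.X * Polynomial.C (1 - p)) *
          PowerSeries.map Polynomial.C (-(C (2 * p) * Y) - (1 - X)) := by
      rw [← hWode, ← hY.ode, hU]
      simp only [map_add, derivative_mul, derivative_map, derivative_C, mul_zero,
        add_zero, map_mul, map_sub, map_one, PowerSeries.map_X, derivative_one]
      ring
    rw [h1, h2, hU, hW, hφ, hψ]
    simp only [map_add, map_sub, map_mul, map_neg, map_one, PowerSeries.map_X, PowerSeries.map_C,
      map_ofNat, Polynomial.smul_eq_C_mul]
    ring
  have hK : (1 - X) * derivative _ (F * U) = coeffDeriv φ (F * U) - C ψ * (F * U) := by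
    rw [coeffDeriv_mul, derivative_mul]
    linear_combination U * hFode + F * hUode
  have h0 : coeff 0 (F * U) = Polynomial.X := by
    simp [hF, hU, hW, meanPathPoly_zero, constantCoeff_map_apply, hY.constantCoeff_eq]
  have hm : ∀ m, coeff (m + 1) (F * U) = 0 := by
    intro m
    induction m using Nat.strong_induction_on with | _ m ih => ?_
    have key : ((m : Polynomial ℝ) + 1) * coeff (m + 1) (F * U) = m * coeff m (F * U) +
        (φ * Polynomial.derivative (coeff m (F * U)) - ψ * coeff m (F * U)) := by
      have := congrArg (coeff m) hK
      rw [coeff_one_sub_X_mul_derivative, map_sub, coeff_coeffDeriv, coeff_C_mul] at this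
      linear_combination this
    have hne : (m : Polynomial ℝ) + 1 ≠ 0 := Nat.cast_add_one_ne_zero m
    refine (mul_eq_zero.1 (key.trans ?_)).resolve_left hne
    clear key
    rcases m with _ | m
    · rw [h0, hφ]
      simp
      ring
    · rw [ih m (Nat.lt_succ_self m)]
      simp
  ext1 m
  rcases m with _ | m
  · rw [h0]
    simp
  · rw [hm m, coeff_C, if_neg m.succ_ne_zero]

/-- The generating function of the expected numbers of paths. -/
noncomputable def expectedPathsSeries : ℝ⟦X⟧ := PowerSeries.mk fun n => expectedPaths p hp (n + 1)

theorem expectedPathsSeries_mul {Y : ℝ⟦X⟧} (hY : IsGrowthSeries p Y) :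
    expectedPathsSeries hp * (1 - X + C p * Y) = 1 := by
  have h := congrArg (PowerSeries.map (Polynomial.evalRingHom (1 : ℝ))) (mk_meanPathPoly_mul hp hY)
  have h1 : PowerSeries.map (Polynomial.evalRingHom (1 : ℝ)) (PowerSeries.mk (meanPathPoly hp)) =
      expectedPathsSeries hp := by
    ext n
    simp [expectedPathsSeries, expectedPaths_succ]
  have h2 : ∀ f : ℝ⟦X⟧, PowerSeries.map (Polynomial.evalRingHom (1 : ℝ))
      (PowerSeries.map Polynomial.C f) = f := fun f => by
    ext n
    simp
  rw [map_mul, map_add, map_mul, h1, h2, h2] at h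
  simp only [PowerSeries.map_C, Polynomial.coe_evalRingHom, Polynomial.eval_mul, Polynomial.eval_X,
    Polynomial.eval_C, one_mul, map_one] at h
  have h3 : (1 - X + C p * Y : ℝ⟦X⟧) = 1 - X - C (1 - 2 * p) * Y + C (1 - p) * Y := by
    simp only [map_sub, map_one, map_mul, map_ofNat]
    ring
  rw [h3, h]

end GeneratingFunction

/-! ### Explicit formulas -/

section ExplicitFormula

open PowerSeries

/-- The power series of `(1 - z) ^ a`. -/
noncomputable def oneSubPow (a : ℝ) : ℝ⟦X⟧ := PowerSeries.mk fun m => (-1) ^ m * Ring.choose a m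

@[simp] theorem coeff_oneSubPow (a : ℝ) (m : ℕ) :
    coeff m (oneSubPow a) = (-1) ^ m * Ring.choose a m := by
  simp [oneSubPow]

theorem oneSubPow_eq_rescale (a : ℝ) :
    oneSubPow a = rescale (-1 : ℝ) (PowerSeries.binomialSeries ℝ a) := by
  ext m
  simp [coeff_rescale]

theorem oneSubPow_add (a b : ℝ) : oneSubPow (a + b) = oneSubPow a * oneSubPow b := by
  simp [oneSubPow_eq_rescale]

theorem oneSubPow_zero : oneSubPow 0 = 1 := by
  simp [oneSubPow_eq_rescale]

theorem oneSubPow_one : oneSubPow 1 = 1 - X := by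
  have : PowerSeries.binomialSeries ℝ (1 : ℝ) = 1 + X := by
    simpa using binomialSeries_nat (R := ℝ) (A := ℝ) 1
  rw [oneSubPow_eq_rescale, this]
  simp [rescale_X, sub_eq_add_neg]

theorem oneSubPow_nat_mul (a : ℝ) (k : ℕ) : oneSubPow (a * k) = oneSubPow a ^ k := by
  induction k with
  | zero => simp [oneSubPow_zero]
  | succ k ih => rw [Nat.cast_succ, mul_add, mul_one, oneSubPow_add, ih, pow_succ]

theorem constantCoeff_oneSubPow (a : ℝ) : constantCoeff (oneSubPow a) = 1 := by
  rw [← coeff_zero_eq_constantCoeff_apply]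
  simp

theorem succ_mul_choose_succ (a : ℝ) (m : ℕ) :
    ((m : ℝ) + 1) * Ring.choose a (m + 1) = (a - m) * Ring.choose a m := by
  have h := Ring.choose_smul_choose a (Nat.le_succ m)
  rw [Nat.choose_succ_self_right, Nat.succ_eq_add_one, Nat.add_sub_cancel_left,
    Ring.choose_one_right, nsmul_eq_mul] at h
  push_cast at h
  rw [h, mul_comm]

theorem oneSubPow_ode (a : ℝ) :
    (1 - X) * derivative ℝ (oneSubPow a) = -(C a * oneSubPow a) := by
  ext m
  rw [coeff_one_sub_X_mul_derivative, map_neg, coeff_C_mul]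
  simp only [coeff_oneSubPow, pow_succ]
  linear_combination (-(-1 : ℝ) ^ m) * succ_mul_choose_succ a m

theorem isGrowthSeries_of_ne_half {p : ℝ} (h : p ≠ 1 / 2) :
    IsGrowthSeries p (C (1 - 2 * p)⁻¹ * (oneSubPow 1 - oneSubPow (2 * p))) := by
  have hne : 1 - 2 * p ≠ 0 := fun h' => h (by linarith)
  refine ⟨by simp [constantCoeff_oneSubPow], ?_⟩
  rw [Derivation.leibniz, derivative_C, smul_zero, add_zero, smul_eq_mul, map_sub, mul_left_comm,
    mul_sub, oneSubPow_ode, oneSubPow_ode, oneSubPow_one, map_one C]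
  have hc : C (1 - 2 * p)⁻¹ * (1 - C (2 * p)) = (1 : ℝ⟦X⟧) := by
    rw [← map_one C, ← map_sub, ← map_mul, inv_mul_cancel₀ hne]
  linear_combination (-(1 - X : ℝ⟦X⟧)) * hc

/-- The power series of `log (1 - z)`. -/
noncomputable def logOneSub : ℝ⟦X⟧ := PowerSeries.mk fun m => -(1 / (m : ℝ))

theorem constantCoeff_logOneSub : constantCoeff logOneSub = 0 := by
  rw [← coeff_zero_eq_constantCoeff_apply]
  -- The constant coefficient is `-(1 / 0)`, which is `0` by convention.
  simp [logOneSub]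

theorem logOneSub_ode : (1 - X) * derivative ℝ logOneSub = -1 := by
  ext m
  rw [coeff_one_sub_X_mul_derivative, logOneSub, coeff_mk, coeff_mk, map_neg, coeff_one]
  have : (m : ℝ) + 1 ≠ 0 := by positivity
  push_cast
  split_ifs with hm
  · simp [hm]
  · have : (m : ℝ) ≠ 0 := Nat.cast_ne_zero.2 hm
    field_simp
    ring

theorem isGrowthSeries_half : IsGrowthSeries (1 / 2 : ℝ) ((1 - X) * logOneSub) := by
  refine ⟨by simp [constantCoeff_logOneSub], ?_⟩
  rw [derivative_mul, mul_add]
  have : derivative ℝ (1 - X : ℝ⟦X⟧) = -1 := by simp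
  have h2 : C (2 * (1 / 2) : ℝ) = (1 : ℝ⟦X⟧) := by norm_num
  rw [this, h2]
  linear_combination (1 - X) * logOneSub_ode

/-- Here `F = G / (1 - T)`, and the tail `F T^N` of the geometric series is divisible by `X^N`,
hence invisible in degrees below `N`. -/
theorem coeff_eq_sum_of_mul_eq_one {F V T : ℝ⟦X⟧} (hT : constantCoeff T = 0)
    (hV : F * (V * (1 - T)) = 1) {G : ℝ⟦X⟧} (hG : G * V = 1) {m N : ℕ} (hm : m < N) :
    coeff m F = ∑ k ∈ Finset.range N, coeff m (G * T ^ k) := by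
  have h1 : F = G * ∑ k ∈ Finset.range N, T ^ k + F * T ^ N := by
    have h2 := geom_sum_mul_neg T N
    have h3 : F * (1 - T) = G := by linear_combination G * hV - F * (1 - T) * hG
    calc F = F * ((∑ i ∈ Finset.range N, T ^ i) * (1 - T) + T ^ N) := by
          rw [h2]
          ring
      _ = _ := by
        rw [← h3]
        ring
  have h4 : coeff m (F * T ^ N) = 0 := by
    have : X ^ N ∣ F * T ^ N := Dvd.dvd.mul_left (pow_dvd_pow_of_dvd (X_dvd_iff.2 hT) N) F
    exact X_pow_dvd_iff.1 this m hm
  conv_lhs => rw [h1]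
  rw [map_add, h4, add_zero, Finset.mul_sum, map_sum]

theorem oneSubPow_neg_one_mul : oneSubPow (-1) * (1 - X) = 1 := by
  rw [← oneSubPow_one, ← oneSubPow_add, neg_add_cancel, oneSubPow_zero]

variable {p : ℝ} (hp : p ∈ Set.Ioo (0 : ℝ) 1)

theorem expectedPaths_eq_of_ne_half (h : p ≠ 1 / 2) (n : ℕ) (hn : 1 ≤ n) :
    expectedPaths p hp n =
      ∑ j ∈ Finset.range n,
        (-1 : ℝ) ^ (n + j - 1) * Ring.choose ((2 * p - 1) * (j : ℝ) - 1) (n - 1) *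
          ∑ k ∈ Finset.range n, (Nat.choose k j : ℝ) * (p / (2 * p - 1)) ^ k := by
  obtain ⟨m, rfl⟩ := Nat.exists_eq_add_of_le' hn
  have hne : 2 * p - 1 ≠ 0 := fun h' => h (by linarith)
  set q := 2 * p - 1 with hq
  have hF := expectedPathsSeries_mul hp (isGrowthSeries_of_ne_half h)
  -- Write `(1 - z)^(2p) = (1 - z) (1 - z)^q`; then `T = (p/q) (1 - (1 - z)^q)`, and the binomial
  -- expansion of `T^k` leaves only powers of `1 - z`.
  have hV : (1 - X + C p * (C (1 - 2 * p)⁻¹ * (oneSubPow 1 - oneSubPow (2 * p))) : ℝ⟦X⟧) =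
      (1 - X) * (1 - C (p / q) * (1 - oneSubPow q)) := by
    have h1 : oneSubPow (2 * p) = (1 - X) * oneSubPow q := by
      rw [← oneSubPow_one, ← oneSubPow_add, hq]
      congr 1
      ring
    have h2 : C (p / q) = -(C p * C (1 - 2 * p)⁻¹ : ℝ⟦X⟧) := by
      rw [← map_mul, ← map_neg, hq]
      congr 1
      rw [show 1 - 2 * p = -(2 * p - 1) by ring, inv_neg]
      field_simp
    rw [h1, h2, oneSubPow_one]
    ring
  rw [hV] at hF
  have hc := coeff_eq_sum_of_mul_eq_one (by simp [constantCoeff_oneSubPow]) hF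
    oneSubPow_neg_one_mul (Nat.lt_succ_self m)
  rw [expectedPathsSeries, coeff_mk] at hc
  rw [hc]
  have hpow : ∀ k, coeff m (oneSubPow (-1) * (C (p / q) * (1 - oneSubPow q)) ^ k) =
      ∑ j ∈ Finset.range (k + 1), (-1 : ℝ) ^ (m + j) * Ring.choose (q * (j : ℝ) - 1) m *
        ((Nat.choose k j : ℝ) * (p / q) ^ k) := by
    intro k
    have hb : (1 - oneSubPow q) ^ k = ∑ j ∈ Finset.range (k + 1),
        C ((-1 : ℝ) ^ j * (Nat.choose k j : ℝ)) * oneSubPow (q * j) := by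
      rw [sub_eq_add_neg, add_comm, add_pow]
      refine Finset.sum_congr rfl fun j _ => ?_
      rw [neg_pow, oneSubPow_nat_mul]
      simp
      ring
    rw [mul_pow, hb, Finset.mul_sum, Finset.mul_sum, map_sum]
    refine Finset.sum_congr rfl fun j _ => ?_
    rw [← map_pow, mul_left_comm, coeff_C_mul, mul_left_comm, coeff_C_mul, ← oneSubPow_add,
      coeff_oneSubPow, show -1 + q * (j : ℝ) = q * j - 1 by ring]
    ring
  simp_rw [hpow, Finset.mul_sum]
  rw [Finset.sum_comm]
  refine (Finset.sum_congr rfl fun k hk => ?_)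
  rw [Finset.mem_range] at hk
  rw [Nat.add_sub_cancel]
  simp_rw [show ∀ j, m + 1 + j - 1 = m + j by intro j; omega]
  -- The range of `j` may be extended beyond `k`, where the binomial coefficient vanishes.
  refine Finset.sum_subset (fun j hj => ?_) fun j _ hj => ?_
  · simp at hj ⊢
    omega
  · have : k < j := by simpa using hj
    simp [Nat.choose_eq_zero_of_lt this]

/-- The polynomial `∏ (1 - s / j)` over `1 ≤ j ≤ m`, as a power series in `s`. -/
noncomputable def harmonicProd : ℕ → ℝ⟦X⟧
  | 0 => 1
  | m + 1 => harmonicProd m * (1 - C ((m : ℝ) + 1)⁻¹ * X)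

/-- Behind this is `(1 - z)^(s-1) = (1 - z)^(-1) exp (s log (1 - z))`: its coefficient of `z^m` is
`∏ (1 - s / j)`, and the powers of `s` are compared. The proof is a recursion in `m` read off from
the differential equation. -/
theorem coeff_oneSubPow_mul_logOneSub_pow (m : ℕ) : ∀ k : ℕ,
    coeff m (oneSubPow (-1) * logOneSub ^ k) = (k.factorial : ℝ) * coeff k (harmonicProd m) := by
  induction m with
  | zero =>
    intro k
    rw [coeff_zero_eq_constantCoeff_apply, map_mul, map_pow, constantCoeff_oneSubPow,
      constantCoeff_logOneSub, harmonicProd, coeff_one]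
    rcases k with _ | k <;> simp
  | succ m ih =>
    intro k
    -- For `k = 0` the truncated exponent `k - 1` is harmless, since the factor `k` vanishes.
    have hode : (1 - X) * derivative ℝ (oneSubPow (-1) * logOneSub ^ k) =
        oneSubPow (-1) * logOneSub ^ k -
          C (k : ℝ) * (oneSubPow (-1) * logOneSub ^ (k - 1)) := by
      have h1 := oneSubPow_ode (-1)
      rw [map_neg, map_one] at h1
      rw [Derivation.leibniz, derivative_pow, smul_eq_mul, smul_eq_mul, map_natCast]
      linear_combination logOneSub ^ k * h1 +
        oneSubPow (-1) * (k * logOneSub ^ (k - 1)) * logOneSub_ode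
    have h := congrArg (coeff m) hode
    rw [coeff_one_sub_X_mul_derivative, map_sub, coeff_C_mul, ih, ih] at h
    have hm : (m : ℝ) + 1 ≠ 0 := by positivity
    refine mul_left_cancel₀ hm ?_
    have hc : coeff k (harmonicProd (m + 1)) = coeff k (harmonicProd m) -
        ((m : ℝ) + 1)⁻¹ * coeff k (harmonicProd m * X) := by
      rw [harmonicProd, mul_sub, mul_one, map_sub, mul_left_comm, coeff_C_mul]
    rw [hc]
    rcases k with _ | k
    · rw [coeff_zero_mul_X, mul_zero, sub_zero]
      rw [Nat.cast_zero, zero_mul, sub_zero] at h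
      linear_combination h
    · rw [coeff_succ_mul_X, Nat.add_sub_cancel] at *
      rw [Nat.factorial_succ] at *
      push_cast at *
      field_simp
      linear_combination h

/-- This is `log ∏ (1 - s / j) = -∑ H^(i) s^i / i`. Both sides have the logarithmic derivative `-∑
H^(i+1) s^i`, so their quotient has derivative zero, and its constant term is `1`. -/
theorem exp_subst_eq_harmonicProd (m : ℕ) :
    (PowerSeries.exp ℝ).subst (PowerSeries.mk fun i => if i = 0 then (0 : ℝ) else
      -((Nat.factorial (i - 1) : ℝ) * harmonicNumber i m) / (i.factorial : ℝ)) =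
      harmonicProd m := by
  set f : ℝ⟦X⟧ := PowerSeries.mk fun i => if i = 0 then (0 : ℝ) else
      -((Nat.factorial (i - 1) : ℝ) * harmonicNumber i m) / (i.factorial : ℝ) with hf
  have hf0 : constantCoeff f = 0 := by
    rw [← coeff_zero_eq_constantCoeff_apply]
    simp [hf]
  have hsub : HasSubst f := HasSubst.of_constantCoeff_zero' hf0
  have hf' : derivative ℝ f = PowerSeries.mk fun i => -harmonicNumber (i + 1) m := by
    ext i
    rw [coeff_derivative, hf, coeff_mk, coeff_mk, if_neg i.succ_ne_zero, Nat.add_sub_cancel,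
      Nat.factorial_succ]
    have h1 : (i.factorial : ℝ) ≠ 0 := by positivity
    have h2 : (i : ℝ) + 1 ≠ 0 := by positivity
    push_cast
    field_simp
  have hP0 : ∀ m, constantCoeff (harmonicProd m) = 1 := by
    intro m
    induction m with
    | zero => simp [harmonicProd]
    | succ m ih => simp [harmonicProd, ih]
  have hP : ∀ m, derivative ℝ (harmonicProd m) =
      harmonicProd m * PowerSeries.mk fun i => -harmonicNumber (i + 1) m := by
    intro m
    induction m with
    | zero =>
      have : (PowerSeries.mk fun i => -harmonicNumber (i + 1) 0 : ℝ⟦X⟧) = 0 := by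
        ext i
        simp [harmonicNumber]
      rw [this]
      simp [harmonicProd]
    | succ m ih =>
      have h1 : (PowerSeries.mk fun i => -harmonicNumber (i + 1) (m + 1) : ℝ⟦X⟧) =
          (PowerSeries.mk fun i => -harmonicNumber (i + 1) m) + PowerSeries.mk fun i => -(((m : ℝ) + 1)⁻¹ ^ (i + 1)) := by
        ext i
        simp [harmonicNumber, Finset.sum_Icc_succ_top, add_comm]
      have h2 : (1 - C ((m : ℝ) + 1)⁻¹ * X) * (PowerSeries.mk fun i => -(((m : ℝ) + 1)⁻¹ ^ (i + 1))) =
          -C ((m : ℝ) + 1)⁻¹ := by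
        ext i
        rw [sub_mul, one_mul, map_sub, mul_assoc, coeff_C_mul, coeff_mk, map_neg, coeff_C]
        rcases i with _ | i
        · simp
        · rw [coeff_succ_X_mul, coeff_mk, if_neg i.succ_ne_zero]
          ring
      have h3 : derivative ℝ (1 - C ((m : ℝ) + 1)⁻¹ * X : ℝ⟦X⟧) = -C ((m : ℝ) + 1)⁻¹ := by
        simp [Derivation.leibniz]
      rw [harmonicProd, derivative_mul, ih, h3, h1]
      linear_combination (-harmonicProd m) * h2
  have hne : constantCoeff (harmonicProd m) ≠ 0 := by simp [hP0]
  have hconst : (PowerSeries.exp ℝ).subst f * (harmonicProd m)⁻¹ = 1 := by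
    refine derivative.ext ?_ ?_
    · rw [derivative_mul, derivative_inv', derivative_subst hsub,
        derivative_exp, hf', hP, derivative_one]
      linear_combination (-(PowerSeries.exp ℝ).subst f * (harmonicProd m)⁻¹ *
        PowerSeries.mk fun i => -harmonicNumber (i + 1) m) * PowerSeries.mul_inv_cancel _ hne
    · rw [map_mul, constantCoeff_inv, hP0]
      have : constantCoeff ((PowerSeries.exp ℝ).subst f) = 1 := by
        rw [← coeff_zero_eq_constantCoeff_apply, coeff_subst' hsub, finsum_eq_single _ 0]
        · simp
        · intro d hd
          simp [hf0, hd]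
      simp [this]
  calc _ = (PowerSeries.exp ℝ).subst f * (harmonicProd m)⁻¹ * harmonicProd m := by
        rw [mul_assoc, PowerSeries.inv_mul_cancel _ hne, mul_one]
    _ = _ := by rw [hconst, one_mul]

theorem expectedPaths_eq_of_half (h : p = 1 / 2) (n : ℕ) (hn : 1 ≤ n) :
    expectedPaths p hp n =
      ∑ k ∈ Finset.range n, (-1 : ℝ) ^ k / 2 ^ k *
        completeBell k
          (fun i => -((Nat.factorial (i - 1) : ℝ) * harmonicNumber i (n - 1))) := by
  obtain ⟨m, rfl⟩ := Nat.exists_eq_add_of_le' hn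
  subst h
  have hF := expectedPathsSeries_mul hp isGrowthSeries_half
  -- Now `T = -(1/2) log (1 - z)`, the source of the factors `(-1)^k / 2^k`.
  have hV : (1 - X + C (1 / 2) * ((1 - X) * logOneSub) : ℝ⟦X⟧) =
      (1 - X) * (1 - C (-1 / 2) * logOneSub) := by
    rw [show (-1 / 2 : ℝ) = -(1 / 2) by norm_num, map_neg]
    ring
  rw [hV] at hF
  have hc := coeff_eq_sum_of_mul_eq_one (by simp [constantCoeff_logOneSub]) hF
    oneSubPow_neg_one_mul (Nat.lt_succ_self m)
  rw [expectedPathsSeries, coeff_mk] at hc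
  rw [hc]
  refine Finset.sum_congr rfl fun k _ => ?_
  rw [completeBell, Nat.add_sub_cancel, exp_subst_eq_harmonicProd, mul_pow, ← map_pow,
    mul_left_comm, coeff_C_mul, coeff_oneSubPow_mul_logOneSub_pow, div_pow]

end ExplicitFormula

/-! ### Taylor series of analytic functions as formal power series -/

section Taylor

open PowerSeries

/-- The Taylor series at `0`. -/
noncomputable def taylorSeries (f : ℂ → ℂ) : ℂ⟦X⟧ :=
  PowerSeries.mk fun n => iteratedDeriv n f 0 / (n.factorial : ℂ)

theorem coeff_taylorSeries (f : ℂ → ℂ) (n : ℕ) :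
    coeff n (taylorSeries f) = iteratedDeriv n f 0 / (n.factorial : ℂ) := by
  simp [taylorSeries]

theorem taylorSeries_congr {f g : ℂ → ℂ} (h : f =ᶠ[𝓝 0] g) : taylorSeries f = taylorSeries g := by
  ext n
  rw [coeff_taylorSeries, coeff_taylorSeries, h.iteratedDeriv_eq]

theorem constantCoeff_taylorSeries (f : ℂ → ℂ) : constantCoeff (taylorSeries f) = f 0 := by
  rw [← coeff_zero_eq_constantCoeff_apply]
  simp [coeff_taylorSeries]

theorem derivative_taylorSeries (f : ℂ → ℂ) :
    derivative ℂ (taylorSeries f) = taylorSeries (deriv f) := by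
  ext n
  rw [coeff_derivative, coeff_taylorSeries, coeff_taylorSeries, iteratedDeriv_succ',
    Nat.factorial_succ]
  have h1 : (n.factorial : ℂ) ≠ 0 := by exact_mod_cast n.factorial_ne_zero
  have h2 : (n : ℂ) + 1 ≠ 0 := Nat.cast_add_one_ne_zero n
  push_cast
  field_simp

theorem taylorSeries_mul {f g : ℂ → ℂ} (hf : AnalyticAt ℂ f 0) (hg : AnalyticAt ℂ g 0) :
    taylorSeries (f * g) = taylorSeries f * taylorSeries g := by
  ext n
  rw [coeff_taylorSeries, iteratedDeriv_mul hf.contDiffAt hg.contDiffAt, coeff_mul,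
    Finset.Nat.sum_antidiagonal_eq_sum_range_succ_mk, Finset.sum_div]
  refine Finset.sum_congr rfl fun i hi => ?_
  have hi : i ≤ n := Nat.lt_succ_iff.1 (Finset.mem_range.1 hi)
  rw [coeff_taylorSeries, coeff_taylorSeries, Nat.cast_choose ℂ hi]
  have h1 : (n.factorial : ℂ) ≠ 0 := by exact_mod_cast n.factorial_ne_zero
  field_simp

theorem taylorSeries_sub {f g : ℂ → ℂ} (hf : AnalyticAt ℂ f 0) (hg : AnalyticAt ℂ g 0) :
    taylorSeries (f - g) = taylorSeries f - taylorSeries g := by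
  ext n
  rw [map_sub, coeff_taylorSeries, iteratedDeriv_sub hf.contDiffAt hg.contDiffAt,
    coeff_taylorSeries, coeff_taylorSeries, sub_div]

theorem taylorSeries_const_mul (c : ℂ) (f : ℂ → ℂ) :
    taylorSeries (fun z => c * f z) = C c * taylorSeries f := by
  ext n
  rw [coeff_C_mul, coeff_taylorSeries, coeff_taylorSeries, iteratedDeriv_const_mul_field,
    mul_div_assoc]

theorem taylorSeries_const (c : ℂ) : taylorSeries (fun _ => c) = C c := by
  ext n
  rw [coeff_taylorSeries, iteratedDeriv_const, coeff_C]
  split_ifs with h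
  · simp [h]
  · simp

theorem taylorSeries_one_sub : taylorSeries (fun z => 1 - z) = 1 - X := by
  ext n
  rw [coeff_taylorSeries, map_sub, coeff_one, coeff_X]
  rcases n with _ | n
  · simp
  · rw [iteratedDeriv_const_sub (Nat.succ_pos n), iteratedDeriv_neg,
      iteratedDeriv_fun_id_zero]
    rcases n with _ | n <;> simp

end Taylor

/-! ### Transfer from growth near the singularity to coefficients -/

section Transfer

open Complex

theorem one_sub_mem_slitPlane {z : ℂ} (hz : ‖z‖ < 1) : 1 - z ∈ slitPlane := by
  refine Or.inl ?_
  have := (le_abs_self _).trans (abs_re_le_norm z)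
  simp
  linarith

theorem analyticAt_comp_one_sub {f : ℂ → ℂ} (hf : DifferentiableOn ℂ f slitPlane) :
    AnalyticAt ℂ (fun z => f (1 - z)) 0 := by
  have h1 : AnalyticAt ℂ f (1 - 0) := by
    rw [sub_zero]
    exact hf.analyticAt (isOpen_slitPlane.mem_nhds one_mem_slitPlane)
  exact h1.comp_of_eq (analyticAt_const.sub analyticAt_id) rfl

/-- The second derivative in a half disc, bounded by the function in a sector. -/
theorem norm_iteratedDeriv_two_le (e : ℝ) : ∃ C, 0 ≤ C ∧ ∀ f : ℂ → ℂ,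
    DifferentiableOn ℂ f slitPlane → ∀ M : ℝ, 0 ≤ M → ∀ δ : ℝ, 0 < δ →
    (∀ w : ℂ, δ / 2 ≤ ‖w‖ → ‖w‖ ≤ 3 → -‖w‖ / 2 ≤ w.re → ‖f w‖ ≤ M * ‖w‖ ^ e) →
    ∀ w : ℂ, δ ≤ ‖w‖ → ‖w‖ ≤ 2 → 0 < w.re → ‖iteratedDeriv 2 f w‖ ≤ C * M * ‖w‖ ^ (e - 2) := by
  -- The sum of both endpoint values serves either sign of `e`.
  set K : ℝ := (3 / 4 : ℝ) ^ e + (5 / 4 : ℝ) ^ e with hK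
  have hK0 : 0 ≤ K := by positivity
  have hpow : ∀ x y : ℝ, 0 < y → 3 / 4 * y ≤ x → x ≤ 5 / 4 * y → x ^ e ≤ K * y ^ e := by
    intro x y hy h1 h2
    have hx : 0 < x := by linarith
    rw [hK, add_mul, ← Real.mul_rpow (by norm_num) hy.le, ← Real.mul_rpow (by norm_num) hy.le]
    rcases le_total 0 e with he | he
    · have := Real.rpow_le_rpow hx.le h2 he
      have : 0 ≤ (3 / 4 * y) ^ e := by positivity
      linarith
    · have := Real.rpow_le_rpow_of_nonpos (by positivity) h1 he
      have : 0 ≤ (5 / 4 * y) ^ e := by positivity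
      linarith
  -- Cauchy's estimate on the disc of radius `‖w‖ / 4` gives `2! * 4^2 = 32`. That disc stays in the
  -- sector and at distance at least `3δ/4` from `0`.
  refine ⟨32 * K, by positivity, fun f hf M hM δ hδ hb w h1 h2 h3 => ?_⟩
  have hw : 0 < ‖w‖ := hδ.trans_le h1
  have hnear : ∀ v ∈ Metric.closedBall w (‖w‖ / 4), 3 / 4 * ‖w‖ ≤ ‖v‖ ∧ ‖v‖ ≤ 5 / 4 * ‖w‖ ∧
      -‖v‖ / 2 ≤ v.re := by
    intro v hv
    have hd : ‖v - w‖ ≤ ‖w‖ / 4 := by rwa [← dist_eq_norm]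
    have e1 := norm_sub_norm_le w v
    rw [norm_sub_rev] at e1
    have e2 := norm_sub_norm_le v w
    have e3 := (abs_le.1 (abs_re_le_norm (v - w))).1
    rw [sub_re] at e3
    refine ⟨?_, ?_, ?_⟩ <;> linarith
  have hsub : Metric.closedBall w (‖w‖ / 4) ⊆ slitPlane := by
    intro v hv
    have hd : ‖v - w‖ ≤ ‖w‖ / 4 := by rwa [← dist_eq_norm]
    by_contra hns
    rw [mem_slitPlane_iff, not_or, not_lt, not_ne_iff] at hns
    have e1 : ‖w‖ ^ 2 ≤ ‖v - w‖ ^ 2 := by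
      rw [Complex.sq_norm, Complex.sq_norm, normSq_apply, normSq_apply, sub_re, sub_im, hns.2]
      nlinarith [hns.1]
    nlinarith [pow_le_pow_left₀ (norm_nonneg _) hd 2, pow_pos hw 2]
  have hdc : DiffContOnCl ℂ f (Metric.ball w (‖w‖ / 4)) :=
    (hf.mono ((Metric.closure_ball_subset_closedBall).trans hsub)).diffContOnCl
  have hle := norm_iteratedDeriv_le_of_forall_mem_sphere_norm_le 2 (by positivity) hdc
    (C := M * (K * ‖w‖ ^ e)) fun v hv => by
      obtain ⟨a1, a2, a3⟩ := hnear v (Metric.sphere_subset_closedBall hv)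
      refine (hb v (by linarith) (by linarith) a3).trans ?_
      exact mul_le_mul_of_nonneg_left (hpow _ _ hw a1 a2) hM
  refine hle.trans (le_of_eq ?_)
  rw [Real.rpow_sub hw, Real.rpow_two]
  simp [Nat.factorial]
  field_simp
  ring

/-- With `d = 1/n ≤ 1/2` the squared distance is `d² + 2 (1 - d)(1 - cos θ)`, and `1 - cos θ ≥
2θ²/π² ≥ θ²/8`. -/
theorem le_norm_one_sub_circleMap {n : ℕ} (hn : 2 ≤ n) {θ : ℝ} (h0 : 0 ≤ θ) (h1 : θ ≤ Real.pi) :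
    (1 / (n : ℝ) + θ) / 5 ≤ ‖1 - circleMap 0 (1 - 1 / (n : ℝ)) θ‖ := by
  have hn' : (2 : ℝ) ≤ n := by exact_mod_cast hn
  have hn1 : 1 / (n : ℝ) ≤ 1 / 2 := one_div_le_one_div_of_le (by norm_num) hn'
  have hn0 : 0 < 1 / (n : ℝ) := by positivity
  set d := 1 / (n : ℝ)
  have hsq : ‖1 - circleMap 0 (1 - d) θ‖ ^ 2 = d ^ 2 + 2 * (1 - d) * (1 - Real.cos θ) := by
    rw [Complex.sq_norm, normSq_apply]
    have hr : (1 - circleMap 0 (1 - d) θ).re = 1 - (1 - d) * Real.cos θ := by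
      simp [circleMap, exp_re, exp_im, ← ofReal_one]
    have hi : (1 - circleMap 0 (1 - d) θ).im = -((1 - d) * Real.sin θ) := by
      simp [circleMap, exp_re, exp_im, ← ofReal_one]
    rw [hr, hi]
    nlinarith [Real.sin_sq_add_cos_sq θ]
  have hcos := Real.cos_le_one_sub_mul_cos_sq (x := θ) (abs_le.2 ⟨by linarith [Real.pi_pos], h1⟩)
  have hpi : 1 / 16 ≤ 1 / Real.pi ^ 2 :=
    one_div_le_one_div_of_le (by positivity) (by nlinarith [Real.pi_lt_four, Real.pi_pos])
  have h2 : θ ^ 2 / 8 ≤ 1 - Real.cos θ := by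
    have : 2 / Real.pi ^ 2 * θ ^ 2 = 2 * θ ^ 2 * (1 / Real.pi ^ 2) := by ring
    nlinarith [sq_nonneg θ]
  refine le_of_sq_le_sq ?_ (norm_nonneg _)
  rw [hsq]
  nlinarith [sq_nonneg (d - θ), sq_nonneg θ]

theorem norm_one_sub_circleMap_symm (r θ : ℝ) :
    ‖1 - circleMap 0 r (2 * Real.pi - θ)‖ = ‖1 - circleMap 0 r θ‖ := by
  have h : 1 - circleMap 0 r (2 * Real.pi - θ) =
      (starRingEnd ℂ) (1 - circleMap 0 r θ) := by
    apply Complex.ext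
    · simp [circleMap, exp_re, exp_im, ← ofReal_one, Real.cos_two_pi_sub]
    · simp [circleMap, exp_re, exp_im, ← ofReal_one, Real.sin_two_pi_sub]
  rw [h, Complex.norm_conj]

/-- By symmetry the upper half circle suffices, where the integrand is at most `5^σ (θ + 1/n)^(-σ)`.
As `σ > 1`, the end `θ = 0` dominates. -/
theorem integral_norm_one_sub_circleMap_le {σ : ℝ} (hσ : 1 < σ) {n : ℕ} (hn : 2 ≤ n) :
    ∫ θ in 0..2 * Real.pi, ‖1 - circleMap 0 (1 - 1 / (n : ℝ)) θ‖ ^ (-σ) ≤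
      2 * 5 ^ σ / (σ - 1) * (n : ℝ) ^ (σ - 1) := by
  have hn' : (2 : ℝ) ≤ n := by exact_mod_cast hn
  have hn0 : 0 < 1 / (n : ℝ) := by positivity
  set d := 1 / (n : ℝ) with hd
  set g : ℝ → ℝ := fun θ => ‖1 - circleMap 0 (1 - d) θ‖ ^ (-σ) with hg
  have hpos : ∀ θ, 0 < ‖1 - circleMap 0 (1 - d) θ‖ := by
    intro θ
    have h1 := norm_sub_norm_le (1 : ℂ) (circleMap 0 (1 - d) θ)
    rw [norm_circleMap_zero, norm_one] at h1
    have h2 : |1 - d| < 1 := by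
      have : d ≤ 1 / 2 := one_div_le_one_div_of_le (by norm_num) hn'
      rw [abs_lt]
      constructor <;> linarith
    linarith
  have hgc : Continuous g :=
    (continuous_const.sub (continuous_circleMap 0 _)).norm.rpow_const fun θ => Or.inl (hpos θ).ne'
  have hsplit : ∫ θ in 0..2 * Real.pi, g θ = 2 * ∫ θ in 0..Real.pi, g θ := by
    rw [← intervalIntegral.integral_add_adjacent_intervals (hgc.intervalIntegrable 0 Real.pi)
      (hgc.intervalIntegrable Real.pi (2 * Real.pi))]
    have h1 : ∫ θ in Real.pi..2 * Real.pi, g θ = ∫ θ in 0..Real.pi, g θ := by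
      have h2 := intervalIntegral.integral_comp_sub_left (a := 0) (b := Real.pi) g (2 * Real.pi)
      rw [sub_zero, show 2 * Real.pi - Real.pi = Real.pi by ring] at h2
      rw [← h2]
      congr 1
      funext θ
      simp only [hg, norm_one_sub_circleMap_symm]
    rw [h1]
    ring
  have hle : ∫ θ in 0..Real.pi, g θ ≤ ∫ θ in 0..Real.pi, 5 ^ σ * (θ + d) ^ (-σ) := by
    refine intervalIntegral.integral_mono_on Real.pi_pos.le (hgc.intervalIntegrable _ _) ?_ ?_
    · refine ContinuousOn.intervalIntegrable ?_
      rw [Set.uIcc_of_le Real.pi_pos.le]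
      refine continuousOn_const.mul (ContinuousOn.rpow_const (by fun_prop) fun θ hθ => Or.inl ?_)
      have := hθ.1
      linarith
    · intro θ hθ
      have h1 := le_norm_one_sub_circleMap hn hθ.1 hθ.2
      have h2 : 0 < d + θ := by linarith [hθ.1]
      calc g θ ≤ ((d + θ) / 5) ^ (-σ) :=
            Real.rpow_le_rpow_of_nonpos (by positivity) h1 (by linarith)
        _ = _ := by
          rw [Real.div_rpow h2.le (by norm_num), Real.rpow_neg (by norm_num : (0 : ℝ) ≤ 5),
            div_inv_eq_mul, mul_comm, add_comm]
  have hint : ∫ θ in 0..Real.pi, 5 ^ σ * (θ + d) ^ (-σ) ≤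
      5 ^ σ / (σ - 1) * (n : ℝ) ^ (σ - 1) := by
    rw [intervalIntegral.integral_const_mul,
      intervalIntegral.integral_comp_add_right (fun x => x ^ (-σ)), integral_rpow, zero_add]
    · have h1 : (0 : ℝ) ≤ (Real.pi + d) ^ (-σ + 1) := by
        have := Real.pi_pos
        positivity
      have h2 : d ^ (-σ + 1) = (n : ℝ) ^ (σ - 1) := by
        rw [hd, one_div, Real.inv_rpow (by positivity), ← Real.rpow_neg (by positivity)]
        congr 1
        ring
      rw [h2, div_mul_eq_mul_div, mul_div_assoc]
      refine mul_le_mul_of_nonneg_left ?_ (by positivity)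
      rw [show -σ + 1 = -(σ - 1) by ring] at h1 ⊢
      rw [div_neg, ← neg_div]
      exact div_le_div_of_nonneg_right (by linarith) (by linarith)
    · right
      refine ⟨by linarith, ?_⟩
      rw [Set.uIcc_of_le (by linarith [Real.pi_pos])]
      intro h
      linarith [h.1]
  rw [hsplit]
  calc 2 * ∫ θ in 0..Real.pi, g θ ≤ 2 * (5 ^ σ / (σ - 1) * (n : ℝ) ^ (σ - 1)) := by linarith
    _ = _ := by ring

/-- Transfer of a bound near the singularity to a bound of a Taylor coefficient. -/
theorem exists_norm_coeff_taylorSeries_le {e : ℝ} (he : e < 1) : ∃ C, 0 ≤ C ∧ ∀ f : ℂ → ℂ,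
    DifferentiableOn ℂ f slitPlane → ∀ M : ℝ, 0 ≤ M → ∀ n : ℕ, 2 ≤ n →
    (∀ w : ℂ, 1 / (2 * (n : ℝ)) ≤ ‖w‖ → ‖w‖ ≤ 3 → -‖w‖ / 2 ≤ w.re → ‖f w‖ ≤ M * ‖w‖ ^ e) →
    ‖PowerSeries.coeff n (taylorSeries fun z => f (1 - z))‖ ≤ C * M * (n : ℝ) ^ (-e - 1) := by
  obtain ⟨K, hK, hder⟩ := norm_iteratedDeriv_two_le e
  -- Differentiating twice turns the exponent `e < 1` into `-σ < -1`, so that a circle of radius `1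
  -- - 1/n` inside the unit disc suffices and no contour around the singularity is needed.
  set σ := 2 - e with hσ
  have hσ1 : 1 < σ := by linarith
  have h5 : 0 ≤ 5 ^ σ / (σ - 1) := div_nonneg (by positivity) (by linarith)
  refine ⟨2 * Real.exp 1 * K * (2 * 5 ^ σ / (σ - 1)), by
    have : 2 * 5 ^ σ / (σ - 1) = 2 * (5 ^ σ / (σ - 1)) := by ring
    rw [this]
    positivity, fun f hf M hM n hn hb => ?_⟩
  have hn' : (2 : ℝ) ≤ n := by exact_mod_cast hn
  have hn0 : 0 < 1 / (n : ℝ) := by positivity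
  have hn2 : 1 / (n : ℝ) ≤ 1 / 2 := one_div_le_one_div_of_le (by norm_num) hn'
  set d := 1 / (n : ℝ) with hd
  set G : ℂ → ℂ := fun z => iteratedDeriv 2 f (1 - z) with hG
  have hG2 : iteratedDeriv 2 (fun z => f (1 - z)) = G := by
    rw [iteratedDeriv_comp_const_sub]
    funext z
    simp [hG]
  have hGd : DifferentiableOn ℂ G (Metric.ball 0 1) := by
    intro z hz
    have hz' : 1 - z ∈ slitPlane := one_sub_mem_slitPlane (by simpa using hz)
    have h1 : AnalyticAt ℂ (iteratedDeriv 2 f) (1 - z) := by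
      rw [iteratedDeriv_eq_iterate]
      exact (hf.analyticAt (isOpen_slitPlane.mem_nhds hz')).iterated_deriv 2
    exact (h1.differentiableAt.comp z (by fun_prop)).differentiableWithinAt
  obtain ⟨m, rfl⟩ := Nat.exists_eq_add_of_le' hn
  -- On this circle `‖1 - z‖ ≥ 1/n`, which is why `f` need be bounded only for `‖w‖ ≥ 1/(2n)`.
  set ρ : NNReal := ⟨1 - d, by linarith⟩ with hρ
  have hρd : (ρ : ℝ) = 1 - d := rfl
  have hρabs : |(ρ : ℝ)| = 1 - d := by
    rw [hρd, abs_of_nonneg (by linarith)]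
  have hρ0 : 0 < ρ := by
    rw [← NNReal.coe_pos, hρd]
    linarith
  have hps := (hGd.mono (Metric.closedBall_subset_ball (by rw [hρd]; linarith) :
    Metric.closedBall (0 : ℂ) ρ ⊆ _)).hasFPowerSeriesOnBall hρ0
  have hcoef : iteratedDeriv m G 0 = (m.factorial : ℂ) * (cauchyPowerSeries G 0 ρ).coeff m := by
    have := hps.factorial_smul 1 m
    rw [iteratedDeriv_eq_iteratedFDeriv, ← this, nsmul_eq_mul]
    rfl
  have hcoefle : ‖(cauchyPowerSeries G 0 ρ).coeff m‖ ≤ ‖cauchyPowerSeries G 0 ρ m‖ := by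
    rw [FormalMultilinearSeries.norm_apply_eq_norm_coef]
  have hcircle := norm_cauchyPowerSeries_le G 0 ρ m
  have hGle : ∀ θ : ℝ, ‖G (circleMap 0 ρ θ)‖ ≤ K * M * ‖1 - circleMap 0 ρ θ‖ ^ (-σ) := by
    intro θ
    have h1 : ‖circleMap 0 (ρ : ℝ) θ‖ = 1 - d := by
      rw [norm_circleMap_zero, hρabs]
    have h2 := norm_sub_norm_le (1 : ℂ) (circleMap 0 ρ θ)
    have h3 := norm_sub_le (1 : ℂ) (circleMap 0 ρ θ)
    rw [h1, norm_one] at h2 h3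
    have h4 := (le_abs_self _).trans (abs_re_le_norm (circleMap 0 ρ θ))
    rw [h1] at h4
    have h5 := hder f hf M hM d hn0 (fun w hw => hb w (by
      rw [hd] at hw
      refine le_trans (le_of_eq ?_) hw
      field_simp)) (1 - circleMap 0 ρ θ) (by linarith) (by linarith) (by
        rw [sub_re, one_re]
        linarith)
    rw [show -σ = e - 2 by rw [hσ]; ring]
    exact h5
  have hcont : ContinuousOn (fun θ : ℝ => ‖1 - circleMap 0 (ρ : ℝ) θ‖ ^ (-σ))
      (Set.uIcc 0 (2 * Real.pi)) := by
    refine ContinuousOn.rpow_const (by fun_prop) fun θ _ => Or.inl ?_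
    have h2 := norm_sub_norm_le (1 : ℂ) (circleMap 0 ρ θ)
    rw [norm_circleMap_zero, hρabs, norm_one] at h2
    intro h
    linarith
  have hintle : ∫ θ in 0..2 * Real.pi, ‖G (circleMap 0 ρ θ)‖ ≤
      K * M * (2 * 5 ^ σ / (σ - 1) * ((m + 2 : ℕ) : ℝ) ^ (σ - 1)) := by
    refine (intervalIntegral.integral_mono_on Real.two_pi_pos.le ?_
      (hcont.const_smul (K * M)).intervalIntegrable fun θ _ => hGle θ).trans ?_
    · refine ContinuousOn.intervalIntegrable (ContinuousOn.norm ?_)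
      refine hGd.continuousOn.comp (continuous_circleMap 0 _).continuousOn fun θ _ => ?_
      rw [mem_ball_zero_iff, norm_circleMap_zero, hρabs]
      linarith
    · simp only [Pi.smul_apply, smul_eq_mul]
      rw [intervalIntegral.integral_const_mul]
      exact mul_le_mul_of_nonneg_left (integral_norm_one_sub_circleMap_le hσ1 hn) (by positivity)
  -- With `n = m + 2` one has `1/ρ = 1 + 1/(m+1)`, whose `m`-th power stays below `e`.
  have hρm : |(ρ : ℝ)|⁻¹ ^ m ≤ Real.exp 1 := by
    have hm1 : (0 : ℝ) < m + 1 := by positivity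
    have h1 : |(ρ : ℝ)|⁻¹ = 1 / ((m : ℝ) + 1) + 1 := by
      rw [hρabs, hd]
      push_cast
      have h2 : 1 - 1 / ((m : ℝ) + 2) = (m + 1) / (m + 2) := by
        field_simp
        ring
      rw [h2, inv_div]
      field_simp
      ring
    rw [h1]
    calc (1 / ((m : ℝ) + 1) + 1) ^ m ≤ Real.exp (1 / ((m : ℝ) + 1)) ^ m :=
          pow_le_pow_left₀ (by positivity) (Real.add_one_le_exp _) m
      _ = Real.exp (m / (m + 1)) := by
          rw [← Real.exp_nat_mul]
          congr 1
          ring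
      _ ≤ _ := Real.exp_le_exp.2 ((div_le_one hm1).2 (by linarith))
  have hpi : (2 * Real.pi)⁻¹ ≤ 1 := inv_le_one_of_one_le₀ (by linarith [Real.pi_gt_three])
  set I := ∫ θ in 0..2 * Real.pi, ‖G (circleMap 0 ρ θ)‖ with hI
  have hI0 : 0 ≤ I := intervalIntegral.integral_nonneg Real.two_pi_pos.le fun _ _ => norm_nonneg _
  have hcb : ‖(cauchyPowerSeries G 0 ρ).coeff m‖ ≤ I * Real.exp 1 := by
    refine hcoefle.trans (hcircle.trans ?_)
    refine mul_le_mul ?_ hρm (by positivity) hI0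
    exact mul_le_of_le_one_left hI0 hpi
  have hiter : iteratedDeriv (m + 2) (fun z => f (1 - z)) 0 = iteratedDeriv m G 0 := by
    rw [← hG2, iteratedDeriv_eq_iterate, iteratedDeriv_eq_iterate, iteratedDeriv_eq_iterate,
      ← Function.iterate_add_apply]
  rw [coeff_taylorSeries, hiter, hcoef, norm_div, norm_mul, Complex.norm_natCast,
    Complex.norm_natCast, Nat.factorial_succ, Nat.factorial_succ]
  have hmf : (0 : ℝ) < m.factorial := by positivity
  have hm2 : (0 : ℝ) < ((m + 2 : ℕ) : ℝ) := by positivity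
  -- Passing back from the second derivative divides by `(m+2)(m+1) ≥ (m+2)²/2`.
  have hfrac : (m.factorial : ℝ) * ‖(cauchyPowerSeries G 0 ρ).coeff m‖ /
      (((m + 1 + 1) * ((m + 1) * m.factorial) : ℕ) : ℝ) ≤
      2 / ((m + 2 : ℕ) : ℝ) ^ 2 * ‖(cauchyPowerSeries G 0 ρ).coeff m‖ := by
    have : (m.factorial : ℝ) * ‖(cauchyPowerSeries G 0 ρ).coeff m‖ /
      (((m + 1 + 1) * ((m + 1) * m.factorial) : ℕ) : ℝ) =
      1 / (((m : ℝ) + 2) * (m + 1)) * ‖(cauchyPowerSeries G 0 ρ).coeff m‖ := by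
      push_cast
      field_simp
      ring
    rw [this]
    refine mul_le_mul_of_nonneg_right ?_ (norm_nonneg _)
    push_cast
    rw [div_le_div_iff₀ (by positivity) (by positivity)]
    nlinarith
  refine hfrac.trans ?_
  have hpow : ((m + 2 : ℕ) : ℝ) ^ (-e - 1) =
      ((m + 2 : ℕ) : ℝ) ^ (σ - 1) / ((m + 2 : ℕ) : ℝ) ^ 2 := by
    rw [← Real.rpow_two, ← Real.rpow_sub hm2]
    congr 1
    rw [hσ]
    ring
  rw [hpow]
  calc 2 / ((m + 2 : ℕ) : ℝ) ^ 2 * ‖(cauchyPowerSeries G 0 ρ).coeff m‖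
      ≤ 2 / ((m + 2 : ℕ) : ℝ) ^ 2 *
        (K * M * (2 * 5 ^ σ / (σ - 1) * ((m + 2 : ℕ) : ℝ) ^ (σ - 1)) * Real.exp 1) := by
        refine mul_le_mul_of_nonneg_left (hcb.trans ?_) (by positivity)
        exact mul_le_mul_of_nonneg_right hintle (Real.exp_pos 1).le
    _ = _ := by ring

end Transfer

/-! ### Removing the pole from the generating function -/

section RemainderFunction

open Complex PowerSeries

theorem eventually_one_sub_mem_slitPlane : ∀ᶠ z : ℂ in 𝓝 0, 1 - z ∈ slitPlane := by
  filter_upwards [Metric.ball_mem_nhds (0 : ℂ) one_pos] with z hz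
  exact one_sub_mem_slitPlane (by simpa using hz)

/-- The substitution `w = 1 - z` turns `y' = 2p y / w + 1` into the equation of a growth series,
whose solution is unique. -/
theorem taylorSeries_comp_one_sub_eq_map {p : ℝ} {Y : ℝ⟦X⟧} (hY : IsGrowthSeries p Y) {y : ℂ → ℂ}
    (hy1 : y 1 = 0) (hy : ∀ w ∈ slitPlane, HasDerivAt y (2 * p * y w / w + 1) w) :
    taylorSeries (fun z => y (1 - z)) = PowerSeries.map ofRealHom Y := by
  have hyd : DifferentiableOn ℂ y slitPlane := fun w hw =>
    (hy w hw).differentiableAt.differentiableWithinAt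
  refine IsGrowthSeries.unique (p := (p : ℂ)) ⟨?_, ?_⟩ (hY.map ofRealHom)
  · rw [constantCoeff_taylorSeries, sub_zero, hy1]
  · have ha := analyticAt_comp_one_sub hyd
    have h1 : AnalyticAt ℂ (fun z : ℂ => 1 - z) 0 := analyticAt_const.sub analyticAt_id
    rw [derivative_taylorSeries, ← taylorSeries_one_sub, ← taylorSeries_mul h1 ha.deriv,
      ← taylorSeries_const_mul]
    have h2 : -taylorSeries (fun z => 2 * (p : ℂ) * y (1 - z)) - taylorSeries (fun z => 1 - z) =
        C (-1) * taylorSeries ((fun z => 2 * (p : ℂ) * y (1 - z)) - fun z => -1 * (1 - z)) := by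
      have h3 : AnalyticAt ℂ (fun z => 2 * (p : ℂ) * y (1 - z)) 0 := analyticAt_const.mul ha
      have h4 : AnalyticAt ℂ (fun z : ℂ => -1 * (1 - z)) 0 := analyticAt_const.mul h1
      rw [taylorSeries_sub h3 h4,
        taylorSeries_const_mul (-1)]
      simp only [map_neg, map_one]
      ring
    rw [h2, ← taylorSeries_const_mul]
    refine taylorSeries_congr ?_
    filter_upwards [eventually_one_sub_mem_slitPlane] with z hz
    have h3 : HasDerivAt (fun z => y (1 - z)) (-(2 * p * y (1 - z) / (1 - z) + 1)) z :=
      (hy (1 - z) hz).comp_const_sub 1 z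
    have h4 := slitPlane_ne_zero hz
    simp only [Pi.mul_apply, Pi.sub_apply]
    rw [h3.deriv]
    field_simp
    ring

/-- The function whose Taylor coefficients are the remainders: the generating function of the
expected numbers of paths without its polar part, in the variable `w = 1 - z`. -/
theorem exists_remainder_function {p : ℝ} (hp : p ∈ Set.Ioo (0 : ℝ) 1) {Y : ℝ⟦X⟧}
    (hY : IsGrowthSeries p Y) {y : ℂ → ℂ} (hy1 : y 1 = 0)
    (hy : ∀ w ∈ slitPlane, HasDerivAt y (2 * p * y w / w + 1) w) {w₀ : ℝ}
    (hw₀ : w₀ ∈ Set.Ioo (0 : ℝ) 1) (hzero : ∀ w ∈ slitPlane, w + p * y w = 0 ↔ w = w₀)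
    (hα : growthRate p = 1 / (1 - w₀)) :
    ∃ R : ℂ → ℂ, DifferentiableOn ℂ R slitPlane ∧
      (∀ w ∈ slitPlane, w ≠ w₀ → R w = 1 / (w + p * y w) - 1 / ((1 - p) * (w - w₀))) ∧
      ∀ n, coeff n (taylorSeries fun z => R (1 - z)) = (remainder p hp (n + 1) : ℂ) := by
  have hp1 : (1 - p : ℂ) ≠ 0 := by
    rw [← ofReal_one, ← ofReal_sub, ofReal_ne_zero]
    exact (sub_pos.2 hp.2).ne'
  have hp0 : (p : ℂ) ≠ 0 := ofReal_ne_zero.2 hp.1.ne'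
  have hw₀s : (w₀ : ℂ) ∈ slitPlane := Or.inl (by simpa using hw₀.1)
  have hw₀0 := slitPlane_ne_zero hw₀s
  set U : ℂ → ℂ := fun w => w + p * y w with hU
  have hUder : ∀ w ∈ slitPlane, HasDerivAt U (1 + p * (2 * p * y w / w + 1)) w := fun w hw =>
    (hasDerivAt_id w).add ((hy w hw).const_mul _)
  have hUd : DifferentiableOn ℂ U slitPlane := fun w hw =>
    (hUder w hw).differentiableAt.differentiableWithinAt
  have hU0 : U w₀ = 0 := (hzero _ hw₀s).2 rfl
  -- At a zero `y w₀ = -w₀ / p`, so the differential equation gives `1 + p (-2 + 1)` regardless of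
  -- `w₀`.
  have hU' : deriv U w₀ = 1 - p := by
    rw [(hUder _ hw₀s).deriv]
    have : y w₀ = -w₀ / p := by
      rw [eq_div_iff hp0]
      linear_combination hU0
    rw [this]
    field_simp
    ring
  have hnhds : slitPlane ∈ 𝓝 (w₀ : ℂ) := isOpen_slitPlane.mem_nhds hw₀s
  -- `D` is `U / (w - w₀)` with the singularity removed and has no zero. A second divided
  -- difference, of `1 / D`, is `1 / U` minus its principal part, since `D w₀ = 1 - p`.
  set D := dslope U w₀ with hD
  have hDd : DifferentiableOn ℂ D slitPlane := (differentiableOn_dslope hnhds).2 hUd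
  have hDw : ∀ w : ℂ, w ≠ w₀ → D w = U w / (w - w₀) := by
    intro w hw
    rw [hD, dslope_of_ne _ hw, slope_def_field, hU0, sub_zero]
  have hD0 : D w₀ = 1 - p := by rw [hD, dslope_same, hU']
  have hDne : ∀ w ∈ slitPlane, D w ≠ 0 := by
    intro w hw
    by_cases h : w = w₀
    · rw [h, hD0]
      exact hp1
    · rw [hDw w h]
      exact div_ne_zero (fun h' => h ((hzero w hw).1 h')) (sub_ne_zero.2 h)
  set V : ℂ → ℂ := fun w => (D w)⁻¹ with hV
  have hVd : DifferentiableOn ℂ V slitPlane := hDd.inv hDne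
  set R := dslope V w₀ with hR
  have hRd : DifferentiableOn ℂ R slitPlane := (differentiableOn_dslope hnhds).2 hVd
  have hRw : ∀ w ∈ slitPlane, w ≠ w₀ → R w = 1 / U w - 1 / ((1 - p) * (w - w₀)) := by
    intro w hw h
    have h1 : U w ≠ 0 := fun h' => h ((hzero w hw).1 h')
    have h2 : w - w₀ ≠ 0 := sub_ne_zero.2 h
    rw [hR, dslope_of_ne _ h, slope_def_field]
    simp only [hV]
    rw [hDw w h, hD0]
    field_simp
  refine ⟨R, hRd, hRw, fun n => ?_⟩
  have han1 : AnalyticAt ℂ (fun z : ℂ => 1 - z) 0 := by fun_prop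
  have hUan := analyticAt_comp_one_sub hUd
  have hTU : taylorSeries (fun z => U (1 - z)) =
      PowerSeries.map ofRealHom (1 - X + C p * Y) := by
    have h1 : (fun z => U (1 - z)) =
        (fun z => 1 - z) - fun z => -(p : ℂ) * y (1 - z) := by
      funext z
      simp only [hU, Pi.sub_apply]
      ring
    have hyd : DifferentiableOn ℂ y slitPlane := fun w hw =>
      (hy w hw).differentiableAt.differentiableWithinAt
    have h2 : AnalyticAt ℂ (fun z => -(p : ℂ) * y (1 - z)) 0 :=
      analyticAt_const.mul (analyticAt_comp_one_sub hyd)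
    rw [h1, taylorSeries_sub han1 h2, taylorSeries_one_sub,
      taylorSeries_const_mul, taylorSeries_comp_one_sub_eq_map hY hy1 hy]
    simp [sub_eq_add_neg]
  have h10 : (1 : ℂ) - w₀ ≠ 0 := by
    rw [← ofReal_one, ← ofReal_sub, ofReal_ne_zero]
    exact (sub_pos.2 hw₀.2).ne'
  have hU1 : U (1 - 0) ≠ 0 := by
    rw [sub_zero]
    intro h
    exact h10 (sub_eq_zero.2 ((hzero 1 one_mem_slitPlane).1 h))
  have hIan : AnalyticAt ℂ (fun z => (U (1 - z))⁻¹) 0 := hUan.inv hU1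
  have hlin : AnalyticAt ℂ (fun z : ℂ => (1 - p) * (1 - z - w₀)) 0 := by fun_prop
  have hQan : AnalyticAt ℂ (fun z : ℂ => ((1 - p) * (1 - z - w₀))⁻¹) 0 :=
    hlin.inv (mul_ne_zero hp1 (by rwa [sub_zero]))
  have hTI : taylorSeries (fun z => (U (1 - z))⁻¹) =
      PowerSeries.map ofRealHom (expectedPathsSeries hp) := by
    have h1 : taylorSeries (fun z => (U (1 - z))⁻¹) * taylorSeries (fun z => U (1 - z)) = 1 := by
      rw [← taylorSeries_mul hIan hUan, ← map_one C, ← taylorSeries_const]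
      refine taylorSeries_congr ?_
      filter_upwards [hUan.continuousAt.eventually_ne hU1] with z hz
      exact inv_mul_cancel₀ hz
    have h2 := congrArg (PowerSeries.map ofRealHom) (expectedPathsSeries_mul hp hY)
    rw [map_mul, ← hTU, map_one] at h2
    linear_combination PowerSeries.map ofRealHom (expectedPathsSeries hp) * h1 -
      taylorSeries (fun z => (U (1 - z))⁻¹) * h2
  -- The exponent `n + 1` matches the network size belonging to the coefficient `n`.
  have hTQ : coeff n (taylorSeries fun z : ℂ => ((1 - p) * (1 - z - w₀))⁻¹) =
      1 / (1 - p) * (1 / (1 - w₀)) ^ (n + 1) := by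
    have h1 : taylorSeries (fun z : ℂ => ((1 - p) * (1 - z - w₀))⁻¹) * (C (1 - w₀ : ℂ) - X) =
        C (1 / (1 - p : ℂ)) := by
      have h2 : C (1 - w₀ : ℂ) - X = taylorSeries ((fun z => 1 - z) - fun _ => (w₀ : ℂ)) := by
        rw [taylorSeries_sub han1 analyticAt_const,
          taylorSeries_one_sub, taylorSeries_const, map_sub, map_one]
        ring
      rw [h2, ← taylorSeries_mul hQan
        (han1.sub analyticAt_const), ← taylorSeries_const]
      refine taylorSeries_congr ?_
      have hc : ContinuousAt (fun z : ℂ => 1 - z - w₀) 0 := by fun_prop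
      filter_upwards [hc.eventually_ne (by simpa using h10)] with z hz
      simp only [Pi.mul_apply, Pi.sub_apply]
      field_simp
    induction n with
    | zero =>
      have := congrArg (coeff 0) h1
      simp only [coeff_zero_eq_constantCoeff, map_mul, map_sub, constantCoeff_C,
        constantCoeff_X, sub_zero] at this ⊢
      rw [zero_add, pow_one, ← this]
      field_simp
    | succ n ih =>
      have := congrArg (coeff (n + 1)) h1
      rw [mul_sub, map_sub, coeff_mul_C, coeff_succ_mul_X, ih, coeff_C, if_neg n.succ_ne_zero] at this
      rw [sub_eq_zero, ← eq_div_iff h10] at this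
      rw [this]
      ring
  have hTR : taylorSeries (fun z => R (1 - z)) = taylorSeries (fun z => (U (1 - z))⁻¹) -
      taylorSeries (fun z : ℂ => ((1 - p) * (1 - z - w₀))⁻¹) := by
    rw [← taylorSeries_sub hIan hQan]
    refine taylorSeries_congr ?_
    have hc : ContinuousAt (fun z : ℂ => 1 - z) 0 := by fun_prop
    filter_upwards [eventually_one_sub_mem_slitPlane,
      hc.eventually_ne (y := (w₀ : ℂ)) (by simpa using sub_ne_zero.1 h10)] with z hz hz'
    rw [hRw _ hz hz']
    simp only [Pi.sub_apply, one_div]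
  rw [hTR, map_sub, hTI, hTQ, coeff_map, expectedPathsSeries, coeff_mk, remainder, hα]
  simp

theorem mem_slitPlane_of_sector {w : ℂ} (h0 : 0 < ‖w‖) (h : -‖w‖ / 2 ≤ w.re) :
    w ∈ slitPlane := by
  by_contra hns
  rw [mem_slitPlane_iff, not_or, not_lt, not_ne_iff] at hns
  have h1 : ‖w‖ = -w.re := by
    have : w = (w.re : ℂ) := Complex.ext rfl (by simpa using hns.2)
    conv_lhs => rw [this]
    rw [norm_real, Real.norm_eq_abs, abs_of_nonpos hns.1]
  linarith

/-- The truncated sector is a compact subset of the slit plane. Thus only the behaviour near `0`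
needs analysis. -/
theorem exists_forall_sector_le {g : ℂ → ℝ} (hg : ContinuousOn g slitPlane) {δ : ℝ} (hδ : 0 < δ) :
    ∃ K, 0 ≤ K ∧ ∀ w : ℂ, δ ≤ ‖w‖ → ‖w‖ ≤ 3 → -‖w‖ / 2 ≤ w.re → g w ≤ K := by
  set S : Set ℂ := {w | δ ≤ ‖w‖ ∧ ‖w‖ ≤ 3 ∧ -‖w‖ / 2 ≤ w.re} with hS
  have hclosed : IsClosed S := by
    refine (isClosed_le continuous_const continuous_norm).inter
      ((isClosed_le continuous_norm continuous_const).inter (isClosed_le ?_ continuous_re))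
    exact (continuous_norm.neg).div_const 2
  have hcomp : IsCompact S := by
    refine Metric.isCompact_of_isClosed_isBounded hclosed
      ((Metric.isBounded_closedBall (x := (0 : ℂ)) (r := 3)).subset fun w hw => ?_)
    simpa using hw.2.1
  have hsub : S ⊆ slitPlane := fun w hw => mem_slitPlane_of_sector (hδ.trans_le hw.1) hw.2.2
  obtain ⟨K, hK⟩ := hcomp.bddAbove_image (hg.mono hsub)
  exact ⟨max K 0, le_max_right _ _, fun w h1 h2 h3 =>
    (hK ⟨w, ⟨h1, h2, h3⟩, rfl⟩).trans (le_max_left _ _)⟩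

/-- Both series satisfy `(1 - z) f' = -a f` and have constant term `1`. -/
theorem taylorSeries_one_sub_cpow (a : ℝ) :
    taylorSeries (fun z => (1 - z) ^ (a : ℂ)) = PowerSeries.map ofRealHom (oneSubPow a) := by
  have hder : ∀ w ∈ slitPlane, HasDerivAt (fun w : ℂ => w ^ (a : ℂ)) (a * w ^ (a - 1 : ℂ)) w :=
    fun w hw => by simpa using (hasDerivAt_id w).cpow_const (c := (a : ℂ)) hw
  have hd : DifferentiableOn ℂ (fun w : ℂ => w ^ (a : ℂ)) slitPlane := fun w hw =>
    (hder w hw).differentiableAt.differentiableWithinAt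
  have han := analyticAt_comp_one_sub hd
  have h1 : AnalyticAt ℂ (fun z : ℂ => 1 - z) 0 := analyticAt_const.sub analyticAt_id
  have hode : (1 - X) * derivative ℂ (taylorSeries fun z => (1 - z) ^ (a : ℂ)) =
      C (-a : ℂ) * taylorSeries fun z => (1 - z) ^ (a : ℂ) := by
    rw [derivative_taylorSeries, ← taylorSeries_one_sub, ← taylorSeries_mul h1 han.deriv,
      ← taylorSeries_const_mul]
    refine taylorSeries_congr ?_
    filter_upwards [eventually_one_sub_mem_slitPlane] with z hz
    have h3 : HasDerivAt (fun z : ℂ => (1 - z) ^ (a : ℂ)) (-(a * (1 - z) ^ (a - 1 : ℂ))) z :=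
      (hder (1 - z) hz).comp_const_sub 1 z
    have h4 := slitPlane_ne_zero hz
    simp only [Pi.mul_apply]
    rw [h3.deriv, cpow_sub _ _ h4, cpow_one]
    field_simp
  ext n
  induction n with
  | zero =>
    rw [coeff_map, coeff_zero_eq_constantCoeff, constantCoeff_taylorSeries,
      coeff_zero_eq_constantCoeff, constantCoeff_oneSubPow]
    simp
  | succ n ih =>
    have e1 := congrArg (coeff n) hode
    rw [coeff_one_sub_X_mul_derivative, coeff_C_mul, ih] at e1
    have e2 := congrArg ofRealHom (congrArg (coeff n) (oneSubPow_ode a))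
    rw [coeff_one_sub_X_mul_derivative, map_neg, coeff_C_mul, map_sub, map_neg, map_mul, map_mul,
      map_mul, map_add, map_natCast, map_one] at e2
    rw [coeff_map] at e1 ⊢
    refine mul_left_cancel₀ (Nat.cast_add_one_ne_zero n : ((n : ℂ) + 1) ≠ 0) ?_
    linear_combination e1 - e2

end RemainderFunction

/-! ### Expansion at the singularity for `p ≠ 1/2` -/

section AwayFromHalf

open Complex

/-- As `|c| < 1`, the imaginary part of `c log w` stays strictly between `-π` and `π`, so taking
logarithms loses no information. With `c = 1 - 2p` this makes the zero of `U` unique. -/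
theorem cpow_eq_ofReal_iff {c : ℝ} (hc : c ≠ 0) (hc1 : |c| < 1) {r : ℝ} (hr : 0 < r) {w : ℂ}
    (hw : w ∈ slitPlane) : w ^ (c : ℂ) = r ↔ w = (r ^ (1 / c) : ℝ) := by
  have hw0 := slitPlane_ne_zero hw
  constructor
  · intro h
    rw [cpow_def_of_ne_zero hw0] at h
    have him : (log w * c).im = arg w * c := by simp [log_im]
    have habs : |(log w * c).im| < Real.pi := by
      rw [him, abs_mul]
      calc |arg w| * |c| ≤ Real.pi * |c| :=
            mul_le_mul_of_nonneg_right (abs_arg_le_pi w) (abs_nonneg c)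
        _ < Real.pi * 1 := mul_lt_mul_of_pos_left hc1 Real.pi_pos
        _ = Real.pi := mul_one _
    have h1 := congrArg log h
    rw [log_exp (abs_lt.1 habs).1 (abs_lt.1 habs).2.le, ← ofReal_log hr.le] at h1
    have h2 : log w = ((Real.log r * (1 / c) : ℝ) : ℂ) := by
      have : (c : ℂ) ≠ 0 := ofReal_ne_zero.2 hc
      push_cast
      field_simp
      exact h1
    rw [← exp_log hw0, h2, ← ofReal_exp, Real.rpow_def_of_pos hr]
  · rintro rfl
    rw [← ofReal_cpow (by positivity), ← Real.rpow_mul hr.le, one_div_mul_cancel hc, Real.rpow_one]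

/-- Near `0` one has `1/U - w^(-s)/A = -B w^t / (A w^s U)` with `|U|` at least `|A| |w|^s / 2`. The
exponent `t - 2s` may be positive, so the value of the pole term at `0` is subtracted too; what is
left of that term is `O(w)`, and `t - 2s ≤ 1`. The constant affects no coefficient of positive
index. -/
theorem exists_norm_remainder_function_sub_le {p : ℝ} (hp : p ∈ Set.Ioo (0 : ℝ) 1) {U R : ℂ → ℂ}
    {w₀ : ℝ} (hw₀ : 0 < w₀) (hR : DifferentiableOn ℂ R slitPlane)
    (hRU : ∀ w ∈ slitPlane, w ≠ w₀ → R w = 1 / U w - 1 / ((1 - p) * (w - w₀)))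
    {A B s t : ℝ} (hA : A ≠ 0) (hst : s < t) (hts : t - 2 * s ≤ 1)
    (hU : ∀ w ∈ slitPlane, U w = A * w ^ (s : ℂ) + B * w ^ (t : ℂ)) :
    ∃ M, 0 ≤ M ∧ ∀ w : ℂ, 0 < ‖w‖ → ‖w‖ ≤ 3 → -‖w‖ / 2 ≤ w.re →
      ‖R w - (A⁻¹ : ℝ) * w ^ ((-s : ℝ) : ℂ) - (1 / ((1 - p) * w₀) : ℝ)‖ ≤
        M * ‖w‖ ^ (t - 2 * s) := by
  have hp1 : 0 < 1 - p := sub_pos.2 hp.2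
  have hA0 : 0 < |A| := abs_pos.2 hA
  obtain ⟨ε, hε, hεb⟩ : ∃ ε > 0, ∀ x : ℝ, 0 < x → x < ε → |B| * x ^ (t - s) ≤ |A| / 2 := by
    have hc : Tendsto (fun x : ℝ => |B| * x ^ (t - s)) (𝓝 0) (𝓝 (|B| * 0 ^ (t - s))) :=
      ((Real.continuous_rpow_const (sub_nonneg.2 hst.le)).tendsto 0).const_mul _
    rw [Real.zero_rpow (sub_pos.2 hst).ne', mul_zero] at hc
    obtain ⟨ε, hε, h⟩ := Metric.eventually_nhds_iff.1 (hc.eventually_lt_const (half_pos hA0))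
    refine ⟨ε, hε, fun x h0 h1 => (h ?_).le⟩
    rwa [Real.dist_eq, sub_zero, abs_of_pos h0]
  set δ := min (ε / 2) (min (w₀ / 2) 1) with hδ
  have hδ0 : 0 < δ := lt_min (half_pos hε) (lt_min (half_pos hw₀) one_pos)
  have hδ1 : δ ≤ ε / 2 := min_le_left _ _
  have hδ2 : δ ≤ w₀ / 2 := (min_le_right _ _).trans (min_le_left _ _)
  have hδ3 : δ ≤ 1 := (min_le_right _ _).trans (min_le_right _ _)
  set f : ℂ → ℂ := fun w => R w - (A⁻¹ : ℝ) * w ^ ((-s : ℝ) : ℂ) - (1 / ((1 - p) * w₀) : ℝ) with hf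
  have hg : ContinuousOn (fun w : ℂ => ‖f w‖ * ‖w‖ ^ (-(t - 2 * s))) slitPlane := by
    refine ContinuousOn.mul (ContinuousOn.norm ?_) ?_
    · refine (hR.continuousOn.sub (continuousOn_const.mul ?_)).sub continuousOn_const
      exact fun w hw => (continuousAt_id.cpow continuousAt_const hw).continuousWithinAt
    · exact continuous_norm.continuousOn.rpow_const fun w hw =>
        Or.inl (norm_ne_zero_iff.2 (slitPlane_ne_zero hw))
  obtain ⟨K, hK, hKb⟩ := exists_forall_sector_le hg hδ0
  set M₀ := 2 * |B| / |A| ^ 2 + 2 / ((1 - p) * w₀ ^ 2) with hM₀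
  have hM₀0 : 0 ≤ M₀ := by positivity
  refine ⟨max K M₀, hK.trans (le_max_left _ _), fun w h0 h3 hre => ?_⟩
  change ‖f w‖ ≤ _
  have hpow : 0 < ‖w‖ ^ (t - 2 * s) := Real.rpow_pos_of_pos h0 _
  rcases le_or_gt δ ‖w‖ with hw | hw
  · have h1 := hKb w hw h3 hre
    rw [Real.rpow_neg h0.le, ← div_eq_mul_inv, div_le_iff₀ hpow] at h1
    exact h1.trans (mul_le_mul_of_nonneg_right (le_max_left _ _) hpow.le)
  · refine le_trans ?_ (mul_le_mul_of_nonneg_right (le_max_right _ _) hpow.le)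
    have hws := mem_slitPlane_of_sector h0 hre
    have hw0 := slitPlane_ne_zero hws
    have hww₀ : w₀ / 2 ≤ ‖w - w₀‖ := by
      have h1 := norm_sub_norm_le (w₀ : ℂ) w
      rw [norm_real, Real.norm_eq_abs, abs_of_pos hw₀, norm_sub_rev] at h1
      linarith
    have hne : w - w₀ ≠ 0 := norm_pos_iff.1 (by linarith)
    have hw₀C : (w₀ : ℂ) ≠ 0 := ofReal_ne_zero.2 hw₀.ne'
    have hp1C : (1 - p : ℂ) ≠ 0 := by
      rw [← ofReal_one, ← ofReal_sub, ofReal_ne_zero]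
      exact hp1.ne'
    have hAC : (A : ℂ) ≠ 0 := ofReal_ne_zero.2 hA
    have hUlow : ‖w‖ ^ s * (|A| / 2) ≤ ‖(A : ℂ) * w ^ (s : ℂ) + B * w ^ (t : ℂ)‖ := by
      have h1 := norm_sub_norm_le ((A : ℂ) * w ^ (s : ℂ)) (-(B * w ^ (t : ℂ)))
      rw [sub_neg_eq_add, norm_neg, norm_mul, norm_mul, norm_real, norm_real, norm_cpow_real,
        norm_cpow_real, Real.norm_eq_abs, Real.norm_eq_abs] at h1
      have h2 : ‖w‖ ^ t = ‖w‖ ^ s * ‖w‖ ^ (t - s) := by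
        rw [← Real.rpow_add h0]
        congr 1
        ring
      have h4 := mul_le_mul_of_nonneg_left (hεb ‖w‖ h0 (by linarith))
        (Real.rpow_nonneg h0.le s)
      rw [h2] at h1
      linarith
    have hsp : 0 < ‖w‖ ^ s := Real.rpow_pos_of_pos h0 _
    have hUne : (A : ℂ) * w ^ (s : ℂ) + B * w ^ (t : ℂ) ≠ 0 :=
      norm_pos_iff.1 (lt_of_lt_of_le (by positivity) hUlow)
    have hwsne : w ^ (s : ℂ) ≠ 0 := by
      rw [← norm_pos_iff, norm_cpow_real]
      exact hsp
    have hfw : f w = -(B * w ^ (t : ℂ)) /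
        (A * w ^ (s : ℂ) * (A * w ^ (s : ℂ) + B * w ^ (t : ℂ))) -
        w / ((1 - p) * w₀ * (w - w₀)) := by
      have h1 : w ≠ w₀ := sub_ne_zero.1 hne
      simp only [hf]
      rw [hRU w hws h1, hU w hws]
      push_cast
      rw [cpow_neg]
      field_simp
      ring
    rw [hfw]
    refine (norm_sub_le _ _).trans ?_
    rw [hM₀, add_mul]
    refine add_le_add ?_ ?_
    · rw [norm_div, norm_neg, norm_mul, norm_mul, norm_mul, norm_real, norm_real, norm_cpow_real,
        norm_cpow_real, Real.norm_eq_abs, Real.norm_eq_abs]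
      calc |B| * ‖w‖ ^ t / (|A| * ‖w‖ ^ s * ‖(A : ℂ) * w ^ (s : ℂ) + B * w ^ (t : ℂ)‖)
          ≤ |B| * ‖w‖ ^ t / (|A| * ‖w‖ ^ s * (‖w‖ ^ s * (|A| / 2))) := by gcongr
        _ = 2 * |B| / |A| ^ 2 * (‖w‖ ^ t / (‖w‖ ^ s * ‖w‖ ^ s)) := by
            field_simp
        _ = _ := by
            rw [← Real.rpow_add h0, ← Real.rpow_sub h0]
            congr 2
            ring
    · have h5 : ‖((1 - p) * w₀ * (w - w₀) : ℂ)‖ = (1 - p) * w₀ * ‖w - w₀‖ := by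
        rw [norm_mul, norm_mul, norm_real, ← ofReal_one, ← ofReal_sub, norm_real,
          Real.norm_eq_abs, Real.norm_eq_abs, abs_of_pos hp1, abs_of_pos hw₀]
      rw [norm_div, h5]
      calc ‖w‖ / ((1 - p) * w₀ * ‖w - w₀‖) ≤ ‖w‖ / ((1 - p) * w₀ * (w₀ / 2)) := by gcongr
        _ = 2 / ((1 - p) * w₀ ^ 2) * ‖w‖ ^ (1 : ℝ) := by
            rw [Real.rpow_one]
            field_simp
        _ ≤ _ := by
            refine mul_le_mul_of_nonneg_left ?_ (by positivity)
            exact Real.rpow_le_rpow_of_exponent_ge h0 (by linarith) hts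

theorem exists_abs_remainder_sub_le {p : ℝ} (hp : p ∈ Set.Ioo (0 : ℝ) 1) (hne : p ≠ 1 / 2)
    {A B s t : ℝ} (hA : A ≠ 0) (hst : s < t) (hts : t - 2 * s < 1)
    (hU : ∀ w ∈ slitPlane, w + p * ((w - w ^ ((2 * p : ℝ) : ℂ)) / (1 - 2 * p)) =
      A * w ^ (s : ℂ) + B * w ^ (t : ℂ)) :
    ∃ C, 0 ≤ C ∧ ∀ n : ℕ, 2 ≤ n →
      |remainder p hp (n + 1) - A⁻¹ * ((-1) ^ n * Ring.choose (-s) n)| ≤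
        C * (n : ℝ) ^ (-(t - 2 * s) - 1) := by
  have hp1 : 0 < 1 - p := sub_pos.2 hp.2
  have hq : 1 - 2 * p ≠ 0 := fun h => hne (by linarith)
  have hqC : (1 - 2 * p : ℂ) ≠ 0 := by exact_mod_cast hq
  have hp1C : (1 - p : ℂ) ≠ 0 := by exact_mod_cast hp1.ne'
  set y : ℂ → ℂ := fun w => (w - w ^ ((2 * p : ℝ) : ℂ)) / (1 - 2 * p) with hy
  have hyder : ∀ w ∈ slitPlane, HasDerivAt y (2 * p * y w / w + 1) w := by
    intro w hw
    have hw0 := slitPlane_ne_zero hw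
    have h1 := ((hasDerivAt_id w).sub
      ((hasDerivAt_id w).cpow_const (c := ((2 * p : ℝ) : ℂ)) hw)).div_const (1 - 2 * p : ℂ)
    refine h1.congr_deriv ?_
    simp only [id, hy]
    rw [cpow_sub _ _ hw0, cpow_one]
    push_cast
    field_simp
    ring
  set w₀ : ℝ := (p / (1 - p)) ^ (1 / (1 - 2 * p)) with hw₀
  have hr : 0 < p / (1 - p) := div_pos hp.1 hp1
  have hw₀pos : 0 < w₀ := Real.rpow_pos_of_pos hr _
  have hw₀1 : w₀ < 1 := by
    rcases lt_or_gt_of_ne hne with h | h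
    · exact Real.rpow_lt_one hr.le ((div_lt_one hp1).2 (by linarith))
        (one_div_pos.2 (by linarith))
    · exact Real.rpow_lt_one_of_one_lt_of_neg ((one_lt_div hp1).2 (by linarith))
        (one_div_neg.2 (by linarith))
  -- The equation says `(1 - p) w = p w^(2p)`, that is `w^(1-2p) = p / (1 - p)`.
  have hzero : ∀ w ∈ slitPlane, w + p * y w = 0 ↔ w = w₀ := by
    intro w hw
    have hw0 := slitPlane_ne_zero hw
    have habs : |1 - 2 * p| < 1 := by
      rw [abs_lt]
      constructor <;> linarith [hp.1, hp.2]
    rw [← cpow_eq_ofReal_iff hq habs hr hw]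
    have h1 : w ^ ((1 - 2 * p : ℝ) : ℂ) = w / w ^ ((2 * p : ℝ) : ℂ) := by
      rw [ofReal_sub, ofReal_one, cpow_sub _ _ hw0, cpow_one]
    have h2 : w ^ ((2 * p : ℝ) : ℂ) ≠ 0 := by simp [cpow_eq_zero_iff, hw0]
    rw [h1]
    simp only [hy]
    generalize w ^ ((2 * p : ℝ) : ℂ) = T at h2 ⊢
    have h3 : w + p * ((w - T) / (1 - 2 * p)) = (w * (1 - p) - p * T) / (1 - 2 * p) := by
      rw [eq_div_iff hqC, add_mul, mul_assoc, div_mul_cancel₀ _ hqC]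
      ring
    push_cast
    rw [h3, div_eq_zero_iff, or_iff_left hqC, div_eq_div_iff h2 hp1C, sub_eq_zero]
  have hα : growthRate p = 1 / (1 - w₀) := by
    rw [growthRate, if_neg hne, growthFormula]
  obtain ⟨R, hRd, hRw, hRc⟩ := exists_remainder_function hp (isGrowthSeries_of_ne_half hne)
    (by simp [hy]) hyder ⟨hw₀pos, hw₀1⟩ hzero hα
  obtain ⟨M, hM, hMb⟩ := exists_norm_remainder_function_sub_le hp hw₀pos hRd hRw hA hst hts.le hU
  obtain ⟨C, hC, hCb⟩ := exists_norm_coeff_taylorSeries_le hts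
  refine ⟨C * M, mul_nonneg hC hM, fun n hn => ?_⟩
  have hcd : DifferentiableOn ℂ (fun w : ℂ => w ^ ((-s : ℝ) : ℂ)) slitPlane := fun w hw =>
    (differentiableAt_id.cpow_const hw).differentiableWithinAt
  have h1 := hCb (fun w => R w - (A⁻¹ : ℝ) * w ^ ((-s : ℝ) : ℂ) - (1 / ((1 - p) * w₀) : ℝ))
    ((hRd.sub (hcd.const_mul _)).sub (differentiableOn_const _)) M hM n hn
    (fun w hw h3 hre => hMb w (lt_of_lt_of_le (by positivity) hw) h3 hre)
  have h2 : (fun z : ℂ => R (1 - z) - (A⁻¹ : ℝ) * (1 - z) ^ ((-s : ℝ) : ℂ) -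
      (1 / ((1 - p) * w₀) : ℝ)) = ((fun z => R (1 - z)) - fun z =>
        ((A⁻¹ : ℝ) : ℂ) * (1 - z) ^ ((-s : ℝ) : ℂ)) - fun _ => ((1 / ((1 - p) * w₀) : ℝ) : ℂ) := rfl
  have ha1 := analyticAt_comp_one_sub hRd
  have ha2 : AnalyticAt ℂ (fun z : ℂ => ((A⁻¹ : ℝ) : ℂ) * (1 - z) ^ ((-s : ℝ) : ℂ)) 0 :=
    analyticAt_const.mul (analyticAt_comp_one_sub hcd)
  rw [h2, taylorSeries_sub (ha1.sub ha2) analyticAt_const, taylorSeries_sub ha1 ha2,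
    taylorSeries_const_mul, taylorSeries_const, taylorSeries_one_sub_cpow, map_sub, map_sub, hRc,
    PowerSeries.coeff_C, if_neg (by omega), sub_zero, PowerSeries.coeff_C_mul,
    PowerSeries.coeff_map, coeff_oneSubPow, ofRealHom_eq_coe, ← ofReal_mul, ← ofReal_sub,
    norm_real, Real.norm_eq_abs] at h1
  exact h1

end AwayFromHalf

/-! ### Quotients of Gamma values -/

section GammaRatio

/-- The coefficients of `(1 - z) ^ (-s)` in terms of the Gamma function. -/
theorem neg_one_pow_mul_choose_neg {s : ℝ} (hs : 0 < s) (n : ℕ) :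
    (-1) ^ n * Ring.choose (-s) n = Real.Gamma (n + s) / (Real.Gamma s * n.factorial) := by
  have hG : Real.Gamma s ≠ 0 := (Real.Gamma_pos_of_pos hs).ne'
  induction n with
  | zero => simp [hG]
  | succ n ih =>
    have h1 := succ_mul_choose_succ (-s) n
    have h2 : Real.Gamma ((n + 1 : ℕ) + s) = (n + s) * Real.Gamma (n + s) := by
      rw [← Real.Gamma_add_one (by positivity)]
      congr 1
      push_cast
      ring
    have hn : (n : ℝ) + 1 ≠ 0 := by positivity
    have hf : (n.factorial : ℝ) ≠ 0 := by positivity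
    refine mul_left_cancel₀ hn ?_
    rw [h2, Nat.factorial_succ]
    rw [eq_div_iff (by positivity)] at ih
    push_cast
    field_simp
    rw [pow_succ]
    linear_combination (-(-1 : ℝ) ^ n * Real.Gamma s * n.factorial) * h1 + (n + s) * ih

/-- Log-convexity of Gamma at `x + s = s (x + 1) + (1 - s) x`. -/
theorem Gamma_add_le {x s : ℝ} (hx : 0 < x) (hs : 0 < s) (hs1 : s < 1) :
    Real.Gamma (x + s) ≤ x ^ s * Real.Gamma x := by
  have hG := Real.Gamma_pos_of_pos hx
  have h := Real.Gamma_mul_add_mul_le_rpow_Gamma_mul_rpow_Gamma (s := x + 1) (t := x) (a := s)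
    (b := 1 - s) (by linarith) hx hs (by linarith) (by ring)
  rw [show s * (x + 1) + (1 - s) * x = x + s by ring, Real.Gamma_add_one hx.ne',
    Real.mul_rpow hx.le hG.le, mul_assoc, ← Real.rpow_add hG, add_sub_cancel, Real.rpow_one] at h
  exact h

/-- The upper bound `Gamma_add_le`, used to go from `x + s` to `x + 1`. -/
theorem le_Gamma_add {x s : ℝ} (hx : 0 < x) (hs : 0 < s) (hs1 : s < 1) :
    x * (x + s) ^ (s - 1) * Real.Gamma x ≤ Real.Gamma (x + s) := by
  have hxs : 0 < x + s := by linarith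
  have h := Gamma_add_le hxs (sub_pos.2 hs1) (by linarith : 1 - s < 1)
  rw [show x + s + (1 - s) = x + 1 by ring, Real.Gamma_add_one hx.ne'] at h
  have h1 : (x + s) ^ (s - 1) * (x + s) ^ (1 - s) = 1 := by
    rw [← Real.rpow_add hxs]
    simp
  calc x * (x + s) ^ (s - 1) * Real.Gamma x = (x + s) ^ (s - 1) * (x * Real.Gamma x) := by ring
    _ ≤ (x + s) ^ (s - 1) * ((x + s) ^ (1 - s) * Real.Gamma (x + s)) := by gcongr
    _ = _ := by rw [← mul_assoc, h1, one_mul]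

/-- `Γ(n + s) / n!` lies between `(n + 1)^(s-1)` and `n^(s-1)`, which differ by at most `n^(s-2)`.
The comparison is with `n + 1`, the network size. -/
theorem abs_neg_one_pow_mul_choose_neg_sub_le {s : ℝ} (hs : 0 < s) (hs1 : s < 1) {n : ℕ}
    (hn : 1 ≤ n) :
    |(-1) ^ n * Ring.choose (-s) n - ((n : ℝ) + 1) ^ (s - 1) / Real.Gamma s| ≤
      (n : ℝ) ^ (s - 2) / Real.Gamma s := by
  have hn0 : (0 : ℝ) < n := by exact_mod_cast hn
  have hG : 0 < Real.Gamma s := Real.Gamma_pos_of_pos hs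
  have hfac : (n.factorial : ℝ) = n * Real.Gamma n := by
    rw [← Real.Gamma_add_one hn0.ne', Real.Gamma_nat_eq_factorial]
  have hGn : 0 < Real.Gamma n := Real.Gamma_pos_of_pos hn0
  set Q := Real.Gamma (n + s) / n.factorial with hQ
  have hup : Q ≤ (n : ℝ) ^ (s - 1) := by
    rw [hQ, hfac, div_le_iff₀ (by positivity)]
    refine (Gamma_add_le hn0 hs hs1).trans (le_of_eq ?_)
    rw [Real.rpow_sub_one hn0.ne']
    field_simp
  have hlow : ((n : ℝ) + 1) ^ (s - 1) ≤ Q := by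
    rw [hQ, hfac, le_div_iff₀ (by positivity)]
    refine le_trans ?_ (le_Gamma_add hn0 hs hs1)
    rw [mul_comm (n : ℝ) (((n : ℝ) + s) ^ (s - 1)), mul_assoc]
    refine mul_le_mul_of_nonneg_right ?_ (by positivity)
    exact Real.rpow_le_rpow_of_nonpos (by positivity) (by linarith) (by linarith)
  have hdiff : (n : ℝ) ^ (s - 1) - ((n : ℝ) + 1) ^ (s - 1) ≤ (n : ℝ) ^ (s - 2) := by
    have h1 : ((n : ℝ) + 1) ^ (s - 1) = (n : ℝ) ^ (s - 1) * (1 + 1 / n) ^ (s - 1) := by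
      rw [← Real.mul_rpow hn0.le (by positivity)]
      congr 1
      field_simp
    have h2 : 1 - 1 / (n : ℝ) ≤ (1 + 1 / (n : ℝ)) ^ (s - 1) := by
      have h3 : (1 + 1 / (n : ℝ)) ^ (-1 : ℝ) ≤ (1 + 1 / (n : ℝ)) ^ (s - 1) :=
        Real.rpow_le_rpow_of_exponent_le (by linarith [one_div_pos.2 hn0]) (by linarith)
      refine le_trans ?_ h3
      have h4 : 0 < 1 / (n : ℝ) := one_div_pos.2 hn0
      rw [Real.rpow_neg_one, ← one_div (1 + 1 / (n : ℝ)), le_div_iff₀ (by positivity)]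
      nlinarith [sq_nonneg (1 / (n : ℝ))]
    have h4 : (n : ℝ) ^ (s - 2) = (n : ℝ) ^ (s - 1) * (1 / n) := by
      rw [show s - 2 = s - 1 - 1 by ring, Real.rpow_sub_one hn0.ne']
      ring
    rw [h1, h4]
    have h5 : 0 < (n : ℝ) ^ (s - 1) := Real.rpow_pos_of_pos hn0 _
    nlinarith
  have h6 : (-1) ^ n * Ring.choose (-s) n - ((n : ℝ) + 1) ^ (s - 1) / Real.Gamma s =
      (Q - ((n : ℝ) + 1) ^ (s - 1)) / Real.Gamma s := by
    rw [neg_one_pow_mul_choose_neg hs, hQ]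
    field_simp
  rw [h6, abs_div, abs_of_pos hG, abs_of_nonneg (by linarith)]
  exact div_le_div_of_nonneg_right (by linarith) hG.le

end GammaRatio

/-! ### Expansion at the singularity for `p = 1/2` -/

section AtHalf

open Complex

/-- The sum equals `(L + 2 + log w) / (w L (1 + log w / 2))` with `L = log N`. In the numerator `L +
log |w| = log (N |w|)` is bounded at the scale `|w| ≈ 1/N`, and `q` controls it elsewhere. The
constant is `576 = 18 * 4 * 8`, from numerator `≤ 18 q`, `|1 + log w / 2| ≥ ℓ / 4` and `L ≤ 8 q ℓ`,
where `ℓ = -log |w|`. -/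
theorem norm_inv_add_two_div_le {N : ℝ} (hN : 3 ≤ N) {w : ℂ} (hw : w ≠ 0) {q : ℝ}
    (hlog : |Real.log (N * ‖w‖)| + 6 ≤ 18 * q) (hlog' : 1 + |Real.log (N * ‖w‖)| ≤ 8 * q)
    (hsmall : 8 ≤ -Real.log ‖w‖) :
    ‖1 / (w + 1 / 2 * (w * log w)) + 2 / Real.log N * w⁻¹‖ ≤
      576 * (q ^ 2 / (‖w‖ * Real.log N ^ 2)) := by
  have hν : 0 < ‖w‖ := norm_pos_iff.2 hw
  have hL : 0 < Real.log N := Real.log_pos (by linarith)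
  set L := Real.log N with hLdef
  set ℓ := -Real.log ‖w‖ with hℓ
  have hsum : L = ℓ + Real.log (N * ‖w‖) := by
    rw [Real.log_mul (by linarith) hν.ne', hℓ]
    ring
  have hx := abs_nonneg (Real.log (N * ‖w‖))
  have hq : 0 < q := by linarith
  have hden : ℓ / 4 ≤ ‖1 + 1 / 2 * log w‖ := by
    have h1 := abs_re_le_norm (1 + 1 / 2 * log w)
    have h2 : (1 + 1 / 2 * log w).re = 1 - ℓ / 2 := by
      have : (1 / 2 : ℂ) = ((1 / 2 : ℝ) : ℂ) := by norm_num
      rw [this, add_re, re_ofReal_mul, log_re, one_re, hℓ]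
      ring
    rw [h2, abs_of_nonpos (by linarith)] at h1
    linarith
  have hnum : ‖(L : ℂ) + 2 + log w‖ ≤ 18 * q := by
    have h1 := norm_le_abs_re_add_abs_im ((L : ℂ) + 2 + log w)
    have h2 : ((L : ℂ) + 2 + log w).re = Real.log (N * ‖w‖) + 2 := by
      rw [add_re, add_re, log_re, ofReal_re, re_ofNat, hsum, hℓ]
      ring
    have h3 : ((L : ℂ) + 2 + log w).im = arg w := by
      rw [add_im, add_im, log_im, ofReal_im, im_ofNat]
      ring
    rw [h2, h3] at h1
    have h4 := abs_add_le (Real.log (N * ‖w‖)) 2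
    rw [abs_two] at h4
    have h5 := abs_arg_le_pi w
    have h6 := Real.pi_lt_four
    linarith
  have hLle : L ≤ 8 * q * ℓ := by
    have h1 := le_abs_self (Real.log (N * ‖w‖))
    have h2 : ℓ * (1 + |Real.log (N * ‖w‖)|) ≤ ℓ * (8 * q) :=
      mul_le_mul_of_nonneg_left hlog' (by linarith)
    nlinarith
  have hℓ0 : 0 < ℓ := by linarith
  have hne : (1 + 1 / 2 * log w) ≠ 0 := norm_pos_iff.1 (by linarith)
  have hLC : (L : ℂ) ≠ 0 := ofReal_ne_zero.2 hL.ne'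
  have heq : 1 / (w + 1 / 2 * (w * log w)) + 2 / (L : ℂ) * w⁻¹ =
      ((L : ℂ) + 2 + log w) / (w * L * (1 + 1 / 2 * log w)) := by
    have h1 : w + 1 / 2 * (w * log w) = w * (1 + 1 / 2 * log w) := by ring
    rw [h1]
    generalize hT : 1 + 1 / 2 * log w = T at hne ⊢
    have h2 : log w = 2 * (T - 1) := by
      rw [← hT]
      ring
    rw [h2]
    field_simp
    ring
  rw [heq, norm_div, norm_mul, norm_mul, norm_real, Real.norm_eq_abs, abs_of_pos hL]
  calc ‖(L : ℂ) + 2 + log w‖ / (‖w‖ * L * ‖1 + 1 / 2 * log w‖)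
      ≤ 18 * q / (‖w‖ * L * (ℓ / 4)) := by gcongr
    _ ≤ _ := by
      rw [← mul_div_assoc 576, div_le_div_iff₀ (by positivity) (by positivity)]
      have : 0 ≤ 18 * q * ‖w‖ * L := by positivity
      nlinarith [mul_le_mul_of_nonneg_left hLle this]

theorem exists_norm_remainder_function_half_le {R : ℂ → ℂ} {w₀ : ℝ} (hw₀ : 0 < w₀)
    (hR : DifferentiableOn ℂ R slitPlane)
    (hRU : ∀ w ∈ slitPlane, w ≠ w₀ →
      R w = 1 / (w + 1 / 2 * (w * log w)) - 1 / ((1 - 1 / 2) * (w - w₀))) :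
    ∃ M, 0 ≤ M ∧ ∀ N : ℝ, 3 ≤ N → ∀ w : ℂ, 1 / (2 * N) ≤ ‖w‖ → ‖w‖ ≤ 3 → -‖w‖ / 2 ≤ w.re →
      ‖R w + 2 / Real.log N * w⁻¹‖ ≤
        M * (N ^ (1 / 2 : ℝ) / Real.log N ^ 2) * ‖w‖ ^ (-(1 / 2) : ℝ) := by
  -- Below `δ` the logarithm is at most `-8`, and the pole `w₀` stays at distance at least `w₀ / 2`.
  set δ := min (Real.exp (-8)) (w₀ / 2) with hδ
  have hδ0 : 0 < δ := lt_min (Real.exp_pos _) (half_pos hw₀)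
  obtain ⟨K, hK, hKb⟩ := exists_forall_sector_le hR.continuousOn.norm hδ0
  refine ⟨32 * (K + 2 / δ) + (576 + 32 * (4 / w₀)), by positivity, fun N hN w h1 h3 hre => ?_⟩
  have hN0 : 0 < N := by linarith
  have hν : 0 < ‖w‖ := lt_of_lt_of_le (by positivity) h1
  have hw := norm_pos_iff.1 hν
  have hws := mem_slitPlane_of_sector hν hre
  have hL1 : 1 ≤ Real.log N := by
    rw [Real.le_log_iff_exp_le hN0]
    linarith [Real.exp_one_lt_d9]
  set L := Real.log N with hL
  set x := N * ‖w‖ with hx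
  have hx0 : 0 < x := by positivity
  have hx2 : 1 / 2 ≤ x := by
    have := mul_le_mul_of_nonneg_left h1 hN0.le
    refine le_trans (le_of_eq ?_) this
    field_simp
  -- The fourth root dominates the logarithm, and `q² / |w|` is just `N^(1/2) |w|^(-1/2)`, a power
  -- that the transfer bound accepts.
  set q := x ^ (1 / 4 : ℝ) with hq
  have hq0 : 0 < q := Real.rpow_pos_of_pos hx0 _
  have hq4 : q ^ 4 = x := by
    rw [hq, ← Real.rpow_natCast, ← Real.rpow_mul hx0.le]
    norm_num
  have hqhalf : 1 / 2 ≤ q := by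
    by_contra h
    have := pow_lt_pow_left₀ (not_le.1 h) hq0.le (by norm_num : (4 : ℕ) ≠ 0)
    rw [hq4] at this
    norm_num at this
    linarith
  have hlogx : |Real.log x| ≤ 4 * q + 1 := by
    rw [abs_le]
    constructor
    · have h4 := Real.log_le_log (by norm_num) hx2
      rw [one_div, Real.log_inv] at h4
      have := Real.log_two_lt_d9
      linarith
    · rw [← hq4, Real.log_pow]
      have := Real.log_le_sub_one_of_pos hq0
      push_cast
      linarith
  have hLν : L ^ 2 * ‖w‖ ≤ 32 * q ^ 2 := by
    have h4 : L ^ 4 ≤ 256 * N := by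
      have h5 : Real.log N ≤ 4 * N ^ (1 / 4 : ℝ) := by
        have h6 := Real.log_le_sub_one_of_pos (Real.rpow_pos_of_pos hN0 (1 / 4))
        rw [Real.log_rpow hN0] at h6
        linarith
      have h7 := pow_le_pow_left₀ (by linarith) h5 4
      rw [mul_pow, ← Real.rpow_natCast (N ^ (1 / 4 : ℝ)), ← Real.rpow_mul hN0.le] at h7
      norm_num at h7
      exact h7
    refine le_of_sq_le_sq ?_ (by positivity)
    calc (L ^ 2 * ‖w‖) ^ 2 = L ^ 4 * ‖w‖ ^ 2 := by ring
      _ ≤ 256 * N * (3 * ‖w‖) := by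
          refine mul_le_mul h4 ?_ (by positivity) (by positivity)
          nlinarith
      _ = 768 * q ^ 4 := by
          rw [hq4, hx]
          ring
      _ ≤ (32 * q ^ 2) ^ 2 := by nlinarith [pow_pos hq0 4]
  have hqN : N ^ (1 / 2 : ℝ) * ‖w‖ ^ (-(1 / 2) : ℝ) = q ^ 2 / ‖w‖ := by
    have h4 : q ^ 2 = N ^ (1 / 2 : ℝ) * ‖w‖ ^ (1 / 2 : ℝ) := by
      rw [hq, ← Real.rpow_natCast, ← Real.rpow_mul hx0.le, ← Real.mul_rpow hN0.le hν.le]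
      norm_num [hx]
    rw [h4, mul_div_assoc, ← Real.rpow_sub_one hν.ne']
    norm_num
  have hL0 : 0 < L := by linarith
  set T := q ^ 2 / (‖w‖ * L ^ 2) with hT
  have hT0 : 0 ≤ T := by positivity
  have htarget : N ^ (1 / 2 : ℝ) / L ^ 2 * ‖w‖ ^ (-(1 / 2) : ℝ) = T := by
    rw [div_mul_eq_mul_div, hqN, hT, div_div]
  -- Hence bounded contributions, from the pole and from `|w| ≥ δ`, are absorbed into the error.
  have hTone : 1 ≤ 32 * T := by
    rw [hT, ← mul_div_assoc, le_div_iff₀ (by positivity)]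
    linarith
  rw [mul_assoc, htarget]
  have hw₀C : 0 < 4 / w₀ := by positivity
  rcases le_or_gt δ ‖w‖ with hwδ | hwδ
  · have h4 := hKb w hwδ h3 hre
    have h5 : ‖2 / (L : ℂ) * w⁻¹‖ ≤ 2 / δ := by
      rw [norm_mul, norm_div, norm_inv, norm_real, Real.norm_eq_abs, abs_of_pos hL0, Complex.norm_ofNat,
        ← div_eq_mul_inv, div_div]
      refine div_le_div_of_nonneg_left (by norm_num) hδ0 ?_
      nlinarith
    have h6 : K + 2 / δ ≤ (K + 2 / δ) * (32 * T) :=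
      le_mul_of_one_le_right (by positivity) hTone
    have h7 : 0 ≤ (576 + 32 * (4 / w₀)) * T := by positivity
    refine (norm_add_le _ _).trans ?_
    linarith
  · have hδ1 : δ ≤ Real.exp (-8) := min_le_left _ _
    have hδ2 : δ ≤ w₀ / 2 := min_le_right _ _
    have hsmall : 8 ≤ -Real.log ‖w‖ := by
      have := Real.log_le_log hν (hwδ.le.trans hδ1)
      rw [Real.log_exp] at this
      linarith
    have hmain := norm_inv_add_two_div_le hN hw (q := q) (by linarith) (by linarith) hsmall
    have hww₀ : w₀ / 2 ≤ ‖w - w₀‖ := by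
      have h1 := norm_sub_norm_le (w₀ : ℂ) w
      rw [norm_real, Real.norm_eq_abs, abs_of_pos hw₀, norm_sub_rev] at h1
      linarith
    have hne : w ≠ w₀ := by
      rintro h
      rw [h, sub_self, norm_zero] at hww₀
      linarith
    have hpole : ‖1 / ((1 - 1 / 2) * (w - w₀))‖ ≤ 4 / w₀ := by
      rw [norm_div, norm_one, norm_mul, show (1 - 1 / 2 : ℂ) = ((1 / 2 : ℝ) : ℂ) by norm_num,
        norm_real, Real.norm_eq_abs, abs_of_pos (by norm_num), div_le_div_iff₀ (by
          have := half_pos hw₀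
          linarith) hw₀]
      linarith
    have hpole' : 4 / w₀ ≤ 4 / w₀ * (32 * T) := le_mul_of_one_le_right hw₀C.le hTone
    have heq : R w + 2 / (L : ℂ) * w⁻¹ = (1 / (w + 1 / 2 * (w * log w)) + 2 / (L : ℂ) * w⁻¹) -
        1 / ((1 - 1 / 2) * (w - w₀)) := by
      rw [hRU w hws hne]
      ring
    rw [heq]
    refine (norm_sub_le _ _).trans ?_
    have h7 : 0 ≤ 32 * (K + 2 / δ) * T := by positivity
    linarith

/-- For each `n` separately, transfer is applied to the remainder function plus `2 / (w log N)`, `N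
= n + 1`. Every coefficient of `1 / w = 1 / (1 - z)` is `1`. The error is of order `N^(1/2) n^(-1/2)
/ log² N`, and `N^(1/2) n^(-1/2) ≤ 2`. -/
theorem exists_abs_remainder_half_add_le (hp : (1 / 2 : ℝ) ∈ Set.Ioo (0 : ℝ) 1) :
    ∃ C, ∀ n : ℕ, 2 ≤ n →
      |remainder (1 / 2) hp (n + 1) + 2 / Real.log ((n + 1 : ℕ) : ℝ)| ≤
        C * (1 / Real.log ((n + 1 : ℕ) : ℝ) ^ 2) := by
  set y : ℂ → ℂ := fun w => w * log w with hy
  have hhalf : ((1 / 2 : ℝ) : ℂ) = 1 / 2 := by norm_num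
  have hyder : ∀ w ∈ slitPlane, HasDerivAt y (2 * (1 / 2 : ℝ) * y w / w + 1) w := by
    intro w hw
    have hw0 := slitPlane_ne_zero hw
    refine ((hasDerivAt_id w).mul (hasDerivAt_log hw)).congr_deriv ?_
    simp only [id, hy]
    rw [hhalf]
    field_simp
  set w₀ : ℝ := Real.exp (-2) with hw₀
  have hw₀1 : w₀ < 1 := Real.exp_lt_one_iff.2 (by norm_num)
  have hzero : ∀ w ∈ slitPlane, w + (1 / 2 : ℝ) * y w = 0 ↔ w = w₀ := by
    intro w hw
    have hw0 := slitPlane_ne_zero hw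
    have h1 : w + (1 / 2 : ℝ) * y w = w / 2 * (log w + 2) := by
      simp only [hy]
      rw [hhalf]
      ring
    rw [h1, mul_eq_zero, or_iff_right (div_ne_zero hw0 two_ne_zero)]
    constructor
    · intro h
      rw [← exp_log hw0, eq_neg_of_add_eq_zero_left h, hw₀]
      simp
    · rintro rfl
      rw [hw₀, ← ofReal_log (Real.exp_pos _).le, Real.log_exp]
      norm_num
  have hα : growthRate (1 / 2) = 1 / (1 - w₀) := by rw [growthRate, if_pos rfl]
  obtain ⟨R, hRd, hRw, hRc⟩ := exists_remainder_function hp isGrowthSeries_half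
    (by simp [hy]) hyder ⟨Real.exp_pos _, hw₀1⟩ hzero hα
  rw [hhalf] at hRw
  obtain ⟨M, hM, hMb⟩ := exists_norm_remainder_function_half_le (Real.exp_pos _) hRd hRw
  obtain ⟨C, hC, hCb⟩ := exists_norm_coeff_taylorSeries_le (e := -(1 / 2)) (by norm_num)
  refine ⟨C * M * 2, fun n hn => ?_⟩
  have hn' : (2 : ℝ) ≤ n := by exact_mod_cast hn
  have hn0 : (0 : ℝ) < n := by linarith
  set N : ℝ := ((n + 1 : ℕ) : ℝ) with hN
  have hNn : N = n + 1 := by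
    rw [hN]
    push_cast
    rfl
  have hcd : DifferentiableOn ℂ (fun w : ℂ => w ^ ((-1 : ℝ) : ℂ)) slitPlane := fun w hw =>
    (differentiableAt_id.cpow_const hw).differentiableWithinAt
  have hL0 : 0 < Real.log N := Real.log_pos (by linarith)
  have h1 := hCb (fun w => R w - ((-(2 / Real.log N) : ℝ) : ℂ) * w ^ ((-1 : ℝ) : ℂ))
    (hRd.sub (hcd.const_mul _)) (M * (N ^ (1 / 2 : ℝ) / Real.log N ^ 2)) (by positivity) n hn
    (fun w hw h3 hre => by
      have h2 : 1 / (2 * N) ≤ 1 / (2 * (n : ℝ)) :=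
        one_div_le_one_div_of_le (by positivity) (by linarith)
      have h4 := hMb N (by linarith) w (h2.trans hw) h3 hre
      have h5 : R w - ((-(2 / Real.log N) : ℝ) : ℂ) * w ^ ((-1 : ℝ) : ℂ) =
          R w + 2 / Real.log N * w⁻¹ := by
        push_cast
        rw [cpow_neg_one]
        ring
      rw [h5]
      exact h4)
  have h2 : (fun z : ℂ => R (1 - z) - ((-(2 / Real.log N) : ℝ) : ℂ) * (1 - z) ^ ((-1 : ℝ) : ℂ)) =
      (fun z => R (1 - z)) - fun z => ((-(2 / Real.log N) : ℝ) : ℂ) * (1 - z) ^ ((-1 : ℝ) : ℂ) :=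
    rfl
  have ha2 : AnalyticAt ℂ
      (fun z : ℂ => ((-(2 / Real.log N) : ℝ) : ℂ) * (1 - z) ^ ((-1 : ℝ) : ℂ)) 0 :=
    analyticAt_const.mul (analyticAt_comp_one_sub hcd)
  have hone : (-1 : ℝ) ^ n * Ring.choose (-1 : ℝ) n = 1 := by
    rw [neg_one_pow_mul_choose_neg one_pos, Real.Gamma_nat_eq_factorial, Real.Gamma_one, one_mul,
      div_self (by positivity)]
  rw [h2, taylorSeries_sub (analyticAt_comp_one_sub hRd) ha2, taylorSeries_const_mul,
    taylorSeries_one_sub_cpow, map_sub, hRc, PowerSeries.coeff_C_mul, PowerSeries.coeff_map,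
    coeff_oneSubPow, hone, map_one, mul_one, ← ofReal_sub, norm_real, Real.norm_eq_abs,
    sub_neg_eq_add] at h1
  refine h1.trans ?_
  have h3 : N ^ (1 / 2 : ℝ) * (n : ℝ) ^ (-(-(1 / 2)) - 1 : ℝ) ≤ 2 := by
    have h4 : N ^ (1 / 2 : ℝ) ≤ (4 * n) ^ (1 / 2 : ℝ) :=
      Real.rpow_le_rpow (by positivity) (by linarith) (by norm_num)
    have h5 : (4 : ℝ) ^ (1 / 2 : ℝ) = 2 := by
      rw [show (4 : ℝ) = 2 ^ (2 : ℝ) by norm_num, ← Real.rpow_mul (by norm_num)]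
      norm_num
    rw [Real.mul_rpow (by norm_num) hn0.le, h5] at h4
    calc N ^ (1 / 2 : ℝ) * (n : ℝ) ^ (-(-(1 / 2)) - 1 : ℝ)
        ≤ 2 * (n : ℝ) ^ (1 / 2 : ℝ) * (n : ℝ) ^ (-(-(1 / 2)) - 1 : ℝ) := by gcongr
      _ = 2 := by
        rw [mul_assoc, ← Real.rpow_add hn0]
        norm_num
  calc C * (M * (N ^ (1 / 2 : ℝ) / Real.log N ^ 2)) * (n : ℝ) ^ (-(-(1 / 2)) - 1 : ℝ)
      = C * M * (N ^ (1 / 2 : ℝ) * (n : ℝ) ^ (-(-(1 / 2)) - 1 : ℝ)) * (1 / Real.log N ^ 2) := by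
        ring
    _ ≤ _ := by gcongr

end AtHalf

/-! ### Asymptotics of the remainder and the limit of the growth rate -/

section Asymptotics

variable {p : ℝ} (hp : p ∈ Set.Ioo (0 : ℝ) 1)

theorem rpow_pred_le {n : ℕ} (hn : 2 ≤ n) {e : ℝ} (he : e ≤ 0) :
    (n : ℝ) ^ e ≤ 2 ^ (-e) * ((n : ℝ) + 1) ^ e := by
  have hn' : (2 : ℝ) ≤ n := by exact_mod_cast hn
  have h1 : (n : ℝ) ^ e ≤ (((n : ℝ) + 1) / 2) ^ e :=
    Real.rpow_le_rpow_of_nonpos (by positivity) (by linarith) he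
  refine h1.trans (le_of_eq ?_)
  rw [Real.div_rpow (by positivity) (by norm_num), Real.rpow_neg (by norm_num)]
  field_simp

theorem isBigO_of_forall_succ_le {f g : ℕ → ℝ} (C : ℝ)
    (h : ∀ n : ℕ, 2 ≤ n → |f (n + 1)| ≤ C * |g (n + 1)|) : f =O[atTop] g := by
  refine IsBigO.of_bound C (eventually_atTop.2 ⟨3, fun N hN => ?_⟩)
  obtain ⟨n, rfl⟩ := Nat.exists_eq_add_of_le' (show 1 ≤ N by omega)
  exact h n (by omega)

theorem isBigO_remainder_of_lt_half (h : p < 1 / 2) :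
    (fun n : ℕ => remainder p hp n -
        (-((1 - 2 * p) / (p * Real.Gamma (2 * p)) * (n : ℝ) ^ (2 * p - 1))))
      =O[atTop] fun n : ℕ => (n : ℝ) ^ (2 * (2 * p - 1)) := by
  have hp0 := hp.1
  have hq : 0 < 1 - 2 * p := by linarith
  have hqC : (1 - 2 * p : ℂ) ≠ 0 := by exact_mod_cast hq.ne'
  have hG : 0 < Real.Gamma (2 * p) := Real.Gamma_pos_of_pos (by linarith)
  have hA : -p / (1 - 2 * p) ≠ 0 := div_ne_zero (neg_ne_zero.2 hp0.ne') hq.ne'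
  obtain ⟨C, hC, hCb⟩ := exists_abs_remainder_sub_le hp h.ne (A := -p / (1 - 2 * p))
    (B := (1 - p) / (1 - 2 * p)) (s := 2 * p) (t := 1) hA (by linarith) (by linarith)
    (fun w _ => by
      generalize w ^ ((2 * p : ℝ) : ℂ) = T
      rw [Complex.ofReal_one, Complex.cpow_one]
      push_cast
      have hw : w = w * (1 - 2 * p) * (1 - 2 * p : ℂ)⁻¹ := by
        rw [mul_assoc, mul_inv_cancel₀ hqC, mul_one]
      linear_combination hw)
  set D := (1 - 2 * p) / p / Real.Gamma (2 * p) with hD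
  have hD0 : 0 ≤ D := by positivity
  refine isBigO_of_forall_succ_le ((C + D) * 2 ^ (-(2 * (2 * p - 1)))) fun n hn => ?_
  have hn1 : (1 : ℝ) ≤ n := by exact_mod_cast (by omega : 1 ≤ n)
  have hAinv : (-p / (1 - 2 * p))⁻¹ = -((1 - 2 * p) / p) := by
    rw [inv_div, div_neg]
  have h1 := hCb n hn
  have h2 := abs_neg_one_pow_mul_choose_neg_sub_le (s := 2 * p) (by linarith) (by linarith)
    (by omega : 1 ≤ n)
  rw [hAinv, show -(1 - 2 * (2 * p)) - 1 = 2 * (2 * p - 1) by ring] at h1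
  -- Two errors arise: the transfer error for the remainder, and the Gamma asymptotics of `c`, of
  -- order `n^(2p-2)` and thus no larger than `n^(4p-2)`.
  set c := (-1 : ℝ) ^ n * Ring.choose (-(2 * p)) n
  have h3 : (n : ℝ) ^ (2 * p - 2) ≤ (n : ℝ) ^ (2 * (2 * p - 1)) :=
    Real.rpow_le_rpow_of_exponent_le hn1 (by linarith)
  have h4 : remainder p hp (n + 1) -
      -((1 - 2 * p) / (p * Real.Gamma (2 * p)) * ((n + 1 : ℕ) : ℝ) ^ (2 * p - 1)) =
      (remainder p hp (n + 1) - -((1 - 2 * p) / p) * c) -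
        (1 - 2 * p) / p * (c - ((n : ℝ) + 1) ^ (2 * p - 1) / Real.Gamma (2 * p)) := by
    push_cast
    field_simp
    ring
  have h5 : |(1 - 2 * p) / p * (c - ((n : ℝ) + 1) ^ (2 * p - 1) / Real.Gamma (2 * p))| ≤
      D * (n : ℝ) ^ (2 * (2 * p - 1)) := by
    rw [abs_mul, abs_of_pos (by positivity : 0 < (1 - 2 * p) / p)]
    calc (1 - 2 * p) / p * |c - ((n : ℝ) + 1) ^ (2 * p - 1) / Real.Gamma (2 * p)|
        ≤ (1 - 2 * p) / p * ((n : ℝ) ^ (2 * p - 2) / Real.Gamma (2 * p)) := by gcongr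
      _ = D * (n : ℝ) ^ (2 * p - 2) := by
          rw [hD]
          ring
      _ ≤ _ := by gcongr
  have h6 := rpow_pred_le hn (e := 2 * (2 * p - 1)) (by linarith)
  rw [h4, abs_of_pos (Real.rpow_pos_of_pos (by positivity) _ :
    0 < ((n + 1 : ℕ) : ℝ) ^ (2 * (2 * p - 1)))]
  calc _ ≤ (C + D) * (n : ℝ) ^ (2 * (2 * p - 1)) := by
        refine (abs_sub _ _).trans ?_
        linarith
    _ ≤ (C + D) * (2 ^ (-(2 * (2 * p - 1))) * ((n : ℝ) + 1) ^ (2 * (2 * p - 1))) := by gcongr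
    _ = _ := by
        push_cast
        ring

theorem isBigO_remainder_of_half_lt (h : 1 / 2 < p) :
    (fun n : ℕ => remainder p hp n - (-((2 * p - 1) / (1 - p))))
      =O[atTop] fun n : ℕ => (n : ℝ) ^ (1 - 2 * p) := by
  have hp1 : 0 < 1 - p := sub_pos.2 hp.2
  have hq : 1 - 2 * p ≠ 0 := by
    intro h'
    linarith
  have hqC : (1 - 2 * p : ℂ) ≠ 0 := by exact_mod_cast hq
  have hA : (1 - p) / (1 - 2 * p) ≠ 0 := div_ne_zero hp1.ne' hq
  obtain ⟨C, hC, hCb⟩ := exists_abs_remainder_sub_le hp h.ne' (A := (1 - p) / (1 - 2 * p))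
    (B := -p / (1 - 2 * p)) (s := 1) (t := 2 * p) hA (by linarith) (by linarith [hp.2])
    (fun w _ => by
      generalize w ^ ((2 * p : ℝ) : ℂ) = T
      rw [Complex.ofReal_one, Complex.cpow_one]
      push_cast
      have hw : w = w * (1 - 2 * p) * (1 - 2 * p : ℂ)⁻¹ := by
        rw [mul_assoc, mul_inv_cancel₀ hqC, mul_one]
      linear_combination hw)
  refine isBigO_of_forall_succ_le (C * 2 ^ (-(1 - 2 * p))) fun n hn => ?_
  have h1 := hCb n hn
  -- Here `s = 1`: the leading term is a multiple of `1 / (1 - z)`, with constant coefficients.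
  have hone : (-1 : ℝ) ^ n * Ring.choose (-1 : ℝ) n = 1 := by
    rw [neg_one_pow_mul_choose_neg one_pos, Real.Gamma_nat_eq_factorial, Real.Gamma_one, one_mul,
      div_self (by positivity)]
  rw [hone, mul_one, inv_div, show -(2 * p - 2 * 1) - 1 = 1 - 2 * p by ring,
    show (1 - 2 * p) / (1 - p) = -((2 * p - 1) / (1 - p)) by ring] at h1
  have h6 := rpow_pred_le hn (e := 1 - 2 * p) (by linarith)
  rw [abs_of_pos (Real.rpow_pos_of_pos (by positivity) _ :
    0 < ((n + 1 : ℕ) : ℝ) ^ (1 - 2 * p))]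
  calc _ ≤ C * (n : ℝ) ^ (1 - 2 * p) := h1
    _ ≤ C * (2 ^ (-(1 - 2 * p)) * ((n : ℝ) + 1) ^ (1 - 2 * p)) := by gcongr
    _ = _ := by
        push_cast
        ring

theorem isBigO_remainder_half (h : p = 1 / 2) :
    (fun n : ℕ => remainder p hp n - (-(2 / Real.log (n : ℝ))))
      =O[atTop] fun n : ℕ => 1 / Real.log (n : ℝ) ^ 2 := by
  subst h
  obtain ⟨C, hC⟩ := exists_abs_remainder_half_add_le hp
  refine isBigO_of_forall_succ_le C fun n hn => ?_
  rw [sub_neg_eq_add, abs_of_nonneg (by positivity : 0 ≤ 1 / Real.log ((n + 1 : ℕ) : ℝ) ^ 2)]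
  exact hC n hn

/-- The logarithm of `(p / (1 - p))^(1 / (1 - 2p))` is `-1/2` times the difference quotient at `1/2`
of `log (p / (1 - p))`, whose derivative there is `4`. -/
theorem tendsto_growthFormula :
    Tendsto growthFormula (𝓝[≠] (1 / 2)) (𝓝 (growthRate (1 / 2))) := by
  have hder : HasDerivAt (fun p : ℝ => Real.log (p / (1 - p))) 4 (1 / 2) := by
    have h1 := (((hasDerivAt_id (1 / 2 : ℝ)).div ((hasDerivAt_id (1 / 2 : ℝ)).const_sub 1)
      (by norm_num)).log (by norm_num))
    refine h1.congr_deriv ?_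
    norm_num
  have hslope := (hasDerivAt_iff_tendsto_slope.1 hder).const_mul (-(1 / 2))
  have hexp : Tendsto (fun p : ℝ => 1 / (1 - Real.exp (-(1 / 2) *
      slope (fun p : ℝ => Real.log (p / (1 - p))) (1 / 2) p))) (𝓝[≠] (1 / 2))
      (𝓝 (1 / (1 - Real.exp (-(1 / 2) * 4)))) := by
    refine tendsto_const_nhds.div (tendsto_const_nhds.sub
      ((Real.continuous_exp.tendsto _).comp hslope)) ?_
    have : Real.exp (-(1 / 2) * 4) < 1 := Real.exp_lt_one_iff.2 (by norm_num)
    linarith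
  have hlim : growthRate (1 / 2) = 1 / (1 - Real.exp (-(1 / 2) * 4)) := by
    rw [growthRate, if_pos rfl]
    norm_num
  rw [hlim]
  refine hexp.congr' ?_
  have hmem : Set.Ioo (0 : ℝ) 1 ∈ 𝓝[≠] (1 / 2 : ℝ) :=
    mem_nhdsWithin_of_mem_nhds (Ioo_mem_nhds (by norm_num) (by norm_num))
  filter_upwards [hmem, self_mem_nhdsWithin] with p hp hne
  have hq : 1 - 2 * p ≠ 0 := fun h => hne (by
    rw [Set.mem_singleton_iff]
    linarith)
  have hq' : p - 1 / 2 ≠ 0 := sub_ne_zero.2 hne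
  rw [growthFormula, Real.rpow_def_of_pos (div_pos hp.1 (sub_pos.2 hp.2)), slope_def_field,
    show (1 / 2 : ℝ) / (1 - 1 / 2) = 1 by norm_num, Real.log_one, sub_zero,
    show p - 1 / 2 = -(1 - 2 * p) / 2 by ring]
  congr 3
  field_simp

end Asymptotics

theorem theorem3 :
    (∀ (p : ℝ) (hp : p ∈ Set.Ioo (0 : ℝ) 1),
      -- the expectation exists
      (∀ n : ℕ, 1 ≤ n →
        Integrable (fun G : Network n => (G.numPaths : ℝ)) (bernoulliNetwork p hp n).toMeasure) ∧
      -- explicit formulas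
      (p ≠ 1 / 2 → ∀ n : ℕ, 1 ≤ n →
        expectedPaths p hp n =
          ∑ j ∈ Finset.range n,
            (-1 : ℝ) ^ (n + j - 1) * Ring.choose ((2 * p - 1) * (j : ℝ) - 1) (n - 1) *
              ∑ k ∈ Finset.range n, (Nat.choose k j : ℝ) * (p / (2 * p - 1)) ^ k) ∧
      (p = 1 / 2 → ∀ n : ℕ, 1 ≤ n →
        expectedPaths p hp n =
          ∑ k ∈ Finset.range n, (-1 : ℝ) ^ k / 2 ^ k *
            completeBell k
              (fun i => -((Nat.factorial (i - 1) : ℝ) * harmonicNumber i (n - 1)))) ∧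
      -- asymptotics of the remainder
      (p < 1 / 2 →
        (fun n : ℕ => remainder p hp n -
            (-((1 - 2 * p) / (p * Real.Gamma (2 * p)) * (n : ℝ) ^ (2 * p - 1))))
          =O[atTop] fun n : ℕ => (n : ℝ) ^ (2 * (2 * p - 1))) ∧
      (p = 1 / 2 →
        (fun n : ℕ => remainder p hp n - (-(2 / Real.log (n : ℝ))))
          =O[atTop] fun n : ℕ => 1 / Real.log (n : ℝ) ^ 2) ∧
      (1 / 2 < p →
        (fun n : ℕ => remainder p hp n - (-((2 * p - 1) / (1 - p))))
          =O[atTop] fun n : ℕ => (n : ℝ) ^ (1 - 2 * p))) ∧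
    -- the growth rate at `1 / 2` is the limit of the growth rates at `p ≠ 1 / 2`
    Tendsto growthFormula (𝓝[≠] (1 / 2)) (𝓝 (growthRate (1 / 2))) :=
  ⟨fun _ hp => ⟨fun n _ =>
      PMF.integrable_of_finite_support (finite_support_bernoulliNetwork hp n) _,
    expectedPaths_eq_of_ne_half hp, expectedPaths_eq_of_half hp, isBigO_remainder_of_lt_half hp,
    isBigO_remainder_half hp, isBigO_remainder_of_half_lt hp⟩, tendsto_growthFormula⟩
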